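/- Let $p\in\mathbb{C}$ with $|p|<1$, let $n\ge 0$ be an integer, and let $q,a$ be nonzero complex numbers. For $x\neq 0$ put $$E(x)=E(x;p)=\prod_{k\ge 0}(1-xp^k)(1-p^{k+1}/x),\qquad (x;q,p)_m=\prod_{k=0}^{m-1}E(xq^k),$$ $(x_1,\dots,x_s;q,p)_m=(x_1;q,p)_m\cdots(x_s;q,p)_m$, and $${_{10}\omega_9}(a_1;a_4,\dots,a_{10};q,p)=\sum_{k=0}^{\infty}\frac{E(a_1q^{2k})}{E(a_1)}\,\frac{(a_1,a_4,\dots,a_{10};q,p)_k\,q^k}{(q,a_1q/a_4,\dots,a_1q/a_{10};q,p)_k}.$$ The series is used only when it terminates, i.e. when some $a_i=q^{-m}$ with $m$ a nonnegative integer $(4\le i\le 10)$; the sum is then over $0\le k\le m$. Let $b,c,d,e,f$ be complex numbers with $bcd=aq$ and $ef=a^2q^{2n+1}$, and let $g=a/b$ or $g=a/e$. Assume that none of the denominators below vanishes (on the left-hand side, in the prefactor on the right-hand side, and in the terms $0\le k\le n$ of the ${_{10}\omega_9}$). Then $$\sum_{k=0}^n \frac{E(aq^{3k})}{E(a)}\,\frac{(b,c,d;q,p)_k}{(aq^2/b,aq^2/c,aq^2/d;q^2,p)_k}\,\frac{(e,f,q^{-2n};q^2,p)_k}{(aq/e,aq/f,aq^{2n+1};q,p)_k}\,q^k$$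 $$=\frac{(aq^2,\;a^2q^2/bce,\;a^2q^2/bdeg,\;agq^2/cd;\,q^2,p)_n}{(a^2q^2/beg,\;agq^2/c,\;aq^2/d,\;a^2q^2/bcde;\,q^2,p)_n}\;{_{10}\omega_9}(ag/c;\,a/c,\,gq^2/c,\,beg/a,\,d,\,f,\,g,\,q^{-2n};\,q^2,p).$$ -/

import Mathlib

/-- The theta function `E(x;p) = (x;p)_∞ (p/x;p)_∞` (for `x ≠ 0` and `|p| < 1`; the two products
then converge absolutely). -/
noncomputable def ellE (x p : ℂ) : ℂ :=
  (∏' k : ℕ, (1 - x * p ^ k)) * ∏' k : ℕ, (1 - p / x * p ^ k)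

/-- The elliptic shifted factorial `(a;q,p)_n = E(a) E(aq) ⋯ E(aq^{n-1})`. -/
noncomputable def ellFac (a q p : ℂ) (n : ℕ) : ℂ :=
  ∏ k ∈ Finset.range n, ellE (a * q ^ k) p

/-- The condensed notation `(a₁,…,a_m;q,p)_n = (a₁;q,p)_n ⋯ (a_m;q,p)_n`. -/
noncomputable def ellFacs (as : List ℂ) (q p : ℂ) (n : ℕ) : ℂ :=
  (as.map fun a => ellFac a q p n).prod

/-- The very-well-poised elliptic hypergeometric series `ω(a₁; a₄,…,a_{r+1}; q,p)`, where `as` is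
the list `a₄,…,a_{r+1}`, so that a list of length 7 gives `₁₀ω₉`. It is only used for terminating
series, where some entry of `as` equals `q^{-n}`: all terms with `k > n` then have a vanishing
numerator. -/
noncomputable def ellOmega (a₁ : ℂ) (as : List ℂ) (q p : ℂ) : ℂ :=
  ∑' k : ℕ, ellE (a₁ * q ^ (2 * k)) p / ellE a₁ p *
    (ellFacs (a₁ :: as) q p k * q ^ k /
      ellFacs (q :: as.map fun x => a₁ * q / x) q p k)

/-! Write every parameter as an exponential and replace `E` by the odd function s(u) = e^{-u/2}
E(e^u). Elliptic shifted factorials become products of values of s times exponential factors, and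
the balancing conditions, now b + c + d = a + h and e + f = 2a + (2n+1)h, make all those
exponentials cancel. The remaining identity needs only that s is odd and satisfies Weierstrass'
three-term relation (`IsOddTheta`).

The three-term relation comes from the Jacobi triple product. With p = r^4 and G(x) = ∑ r^{s²} x^s,
multiplying two theta series and passing to the sum and difference of the indices shows that
E(xy)E(x/y) is a constant times x (G(x)G(-y) - G(-x)G(y)). The bracket is a 2×2 determinant, so
`ellE_three_term` is the Plücker relation for four vectors in the plane.

Two summations are deduced from it: the Frenkel–Turaev sum (`sum_ftTerm`), by induction on its
length, and a bibasic sum (`sum_bibasicTerm`), by telescoping. For g = a/b, the part of the k-th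
cubic term depending on e, f, n is an explicit quotient times the value of a Frenkel–Turaev sum of
length n - k in base q². Expanding that value as a sum over i and collecting the terms with k + i =
j leaves a bibasic sum over k, whose value turns the j-th contribution into the j-th term of the
₁₀ω₉ series. The case g = a/e follows by applying the elliptic Bailey transformation
(`sum_omegaTerm`) to the series for g = a/b; that transformation is again an interchange of
summations between two uses of Frenkel–Turaev.

These steps divide by many values of s that the theorem does not assume nonzero, so they are carried
out for generic parameters. The zeros of s are countable, hence on a suitable complex line through
the given parameters the generic points are dense. Both sides are continuous at the given point
because the denominators written in the theorem do not vanish there (`sum_cubic_eq_of_ne_zero`). -/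

open Filter Topology

/-! ### The Jacobi triple product -/

/-- The finite Euler product `(p;p)_m`. -/
noncomputable def eulerProd (p : ℂ) (m : ℕ) : ℂ := ∏ k ∈ Finset.range m, (1 - p ^ (k + 1))

/-- The Gaussian binomial coefficient, defined by its Pascal recursion. -/
noncomputable def gaussBinom (p : ℂ) : ℕ → ℕ → ℂ
  | _, 0 => 1
  | 0, _ + 1 => 0
  | m + 1, j + 1 => gaussBinom p m (j + 1) + p ^ (m - j) * gaussBinom p m j

theorem gaussBinom_eq_zero_of_lt (p : ℂ) : ∀ m j : ℕ, m < j → gaussBinom p m j = 0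
  | 0, j + 1, _ => by simp [gaussBinom]
  | m + 1, j + 1, h => by
    rw [gaussBinom, gaussBinom_eq_zero_of_lt p m (j + 1) (by omega),
      gaussBinom_eq_zero_of_lt p m j (by omega)]
    simp

theorem eulerProd_succ (p : ℂ) (m : ℕ) :
    eulerProd p (m + 1) = eulerProd p m * (1 - p ^ (m + 1)) :=
  Finset.prod_range_succ _ _

/-- The factorial formula for Gaussian binomials, kept free of division so that it needs no
condition on p. -/
theorem gaussBinom_mul_eulerProd (p : ℂ) : ∀ m j : ℕ, j ≤ m →
    gaussBinom p m j * eulerProd p j * eulerProd p (m - j) = eulerProd p m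
  | m, 0, _ => by cases m <;> simp [gaussBinom, eulerProd]
  | m + 1, j + 1, h => by
    have hj : gaussBinom p m j * eulerProd p j * eulerProd p (m - j) = eulerProd p m :=
      gaussBinom_mul_eulerProd p m j (by omega)
    rcases Nat.lt_or_ge j m with hlt | hge
    · obtain ⟨i, rfl⟩ : ∃ i, m = j + 1 + i := ⟨m - (j + 1), by omega⟩
      have hj' := gaussBinom_mul_eulerProd p (j + 1 + i) (j + 1) (by omega)
      rw [show j + 1 + i - (j + 1) = i by omega, eulerProd_succ] at hj'
      rw [show j + 1 + i - j = i + 1 by omega, eulerProd_succ] at hj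
      rw [gaussBinom, show j + 1 + i + 1 - (j + 1) = i + 1 by omega,
        show j + 1 + i - j = i + 1 by omega, eulerProd_succ p i, eulerProd_succ p j,
        eulerProd_succ p (j + 1 + i)]
      -- The Pascal recursion corresponds to 1 - p^{i+j+2} = (1 - p^{i+1}) + p^{i+1}(1 - p^{j+1}).
      linear_combination (1 - p ^ (i + 1)) * hj' + p ^ (i + 1) * (1 - p ^ (j + 1)) * hj
    · obtain rfl : j = m := by omega
      rw [gaussBinom, gaussBinom_eq_zero_of_lt p j (j + 1) (by omega), Nat.sub_self, Nat.sub_self,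
        eulerProd_succ]
      rw [Nat.sub_self] at hj
      linear_combination (1 - p ^ (j + 1)) * hj

/-- The finite q-binomial theorem: multiplying by the last factor 1 + z p^m reproduces the Pascal
recursion on coefficients. -/
theorem prod_one_add_mul_pow (p z : ℂ) (m : ℕ) :
    ∏ k ∈ Finset.range m, (1 + z * p ^ k) =
      ∑ j ∈ Finset.range (m + 1), gaussBinom p m j * p ^ (j.choose 2) * z ^ j := by
  induction m with
  | zero => simp [gaussBinom]
  | succ m ih =>
    have hshift : ∑ j ∈ Finset.range (m + 1),
        gaussBinom p m (j + 1) * p ^ ((j + 1).choose 2) * z ^ (j + 1) + 1 =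
        ∑ j ∈ Finset.range (m + 1), gaussBinom p m j * p ^ (j.choose 2) * z ^ j := by
      have h1 := Finset.sum_range_succ' (fun j => gaussBinom p m j * p ^ (j.choose 2) * z ^ j)
        (m + 1)
      have h2 := Finset.sum_range_succ (fun j => gaussBinom p m j * p ^ (j.choose 2) * z ^ j)
        (m + 1)
      rw [gaussBinom_eq_zero_of_lt p m (m + 1) (by omega)] at h2
      have h3 : gaussBinom p m 0 = 1 := by cases m <;> simp [gaussBinom]
      simp only [h3] at h1
      rw [h2] at h1
      simpa using h1.symm
    rw [Finset.prod_range_succ, ih, Finset.sum_range_succ' _ (m + 1), mul_add, mul_one]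
    have hterm : ∀ j ∈ Finset.range (m + 1),
        gaussBinom p (m + 1) (j + 1) * p ^ ((j + 1).choose 2) * z ^ (j + 1) =
        gaussBinom p m (j + 1) * p ^ ((j + 1).choose 2) * z ^ (j + 1) +
          gaussBinom p m j * p ^ (j.choose 2) * z ^ j * (z * p ^ m) := by
      intro j hj
      have hj' : j ≤ m := by simpa [Nat.lt_succ_iff] using hj
      have hc : (j + 1).choose 2 = j + j.choose 2 := by
        rw [Nat.choose_succ_succ' j 1, Nat.choose_one_right]
      have hp : p ^ m = p ^ (m - j) * p ^ j := by rw [← pow_add]; congr 1; omega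
      rw [gaussBinom, hc, hp]
      ring
    rw [Finset.sum_congr rfl hterm, Finset.sum_add_distrib, ← Finset.sum_mul]
    have h0 : gaussBinom p (m + 1) 0 = 1 := by simp [gaussBinom]
    rw [h0]
    simp only [Nat.choose_zero_succ, pow_zero, mul_one]
    linear_combination -hshift

/-- The infinite product `(x;p)_∞`. -/
noncomputable def qProd (p x : ℂ) : ℂ := ∏' k : ℕ, (1 - x * p ^ k)

theorem ellE_eq_qProd (x p : ℂ) : ellE x p = qProd p x * qProd p (p / x) := rfl

theorem summable_norm_mul_pow {p : ℂ} (hp : ‖p‖ < 1) (x : ℂ) :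
    Summable fun k : ℕ => ‖-(x * p ^ k)‖ := by
  simpa [norm_mul, norm_pow] using
    (summable_geometric_of_lt_one (norm_nonneg p) hp).mul_left ‖x‖

theorem tendsto_qProd {p : ℂ} (hp : ‖p‖ < 1) (x : ℂ) :
    Tendsto (fun n => ∏ k ∈ Finset.range n, (1 - x * p ^ k)) atTop (𝓝 (qProd p x)) := by
  have h := (multipliable_one_add_of_summable (summable_norm_mul_pow hp x)).hasProd
  simpa [qProd, sub_eq_add_neg] using h.tendsto_prod_nat

theorem qProd_ne_zero {p : ℂ} (hp : ‖p‖ < 1) {x : ℂ} (hx : ∀ k : ℕ, x * p ^ k ≠ 1) :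
    qProd p x ≠ 0 := by
  have h := tprod_one_add_ne_zero_of_summable (f := fun k : ℕ => -(x * p ^ k))
    (fun k => by
      intro h0
      exact hx k (by linear_combination -h0)) (summable_norm_mul_pow hp x)
  simpa [qProd, sub_eq_add_neg] using h

theorem qProd_eq_mul {p : ℂ} (hp : ‖p‖ < 1) (x : ℂ) :
    qProd p x = (1 - x) * qProd p (p * x) := by
  refine tendsto_nhds_unique ((tendsto_qProd hp x).comp (tendsto_add_atTop_nat 1)) ?_
  refine ((tendsto_qProd hp (p * x)).const_mul (1 - x)).congr fun n => ?_
  rw [Function.comp, Finset.prod_range_succ', mul_comm]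
  simp only [pow_zero, mul_one]
  congr 1
  exact Finset.prod_congr rfl fun k _ => by ring

theorem continuous_qProd {p : ℂ} (hp : ‖p‖ < 1) : Continuous (qProd p) := by
  refine continuous_iff_continuousAt.2 fun x₀ => ?_
  have hopen : IsOpen (Metric.ball (0 : ℂ) (‖x₀‖ + 1)) := Metric.isOpen_ball
  have hu : Summable fun k : ℕ => (‖x₀‖ + 1) * ‖p‖ ^ k :=
    (summable_geometric_of_lt_one (norm_nonneg p) hp).mul_left _
  have h := Summable.hasProdLocallyUniformlyOn_one_add (f := fun (k : ℕ) (x : ℂ) => -(x * p ^ k)) hopen hu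
    (Eventually.of_forall fun k x hx => by
      rw [norm_neg, norm_mul, norm_pow]
      have : ‖x‖ ≤ ‖x₀‖ + 1 := le_of_lt (by simpa using hx)
      gcongr)
    (fun k => by fun_prop)
  have hc : ContinuousOn (fun x : ℂ => ∏' k : ℕ, (1 + -(x * p ^ k)))
      (Metric.ball (0 : ℂ) (‖x₀‖ + 1)) :=
    TendstoLocallyUniformlyOn.continuousOn h (Frequently.of_forall fun s => by fun_prop)
  have hx : x₀ ∈ Metric.ball (0 : ℂ) (‖x₀‖ + 1) := by simp
  have := hc.continuousAt (hopen.mem_nhds hx)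
  have heq : qProd p = fun x : ℂ => ∏' k : ℕ, (1 + -(x * p ^ k)) := by
    funext x
    simp only [qProd, sub_eq_add_neg]
  rwa [heq]

/-- The terms of the bilateral series for the theta function with `p = r ^ 4`. -/
noncomputable def thetaTerm (r x : ℂ) (j : ℤ) : ℂ := (-x) ^ j * r ^ (2 * j * (j - 1))

theorem pow_choose_two_eq_zpow {r : ℂ} (hr : r ≠ 0) (i : ℕ) :
    (r ^ 4) ^ (i.choose 2) = r ^ (2 * (i : ℤ) * (i - 1)) := by
  induction i with
  | zero => simp
  | succ i ih =>
    rw [Nat.choose_succ_succ' i 1, Nat.choose_one_right, pow_add, ih, ← pow_mul, ← zpow_natCast,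
      ← zpow_add₀ hr]
    congr 1
    push_cast
    ring

theorem prod_neg_mul_zpow {r x : ℂ} (hr : r ≠ 0) (hx : x ≠ 0) (n : ℕ) :
    ∏ k ∈ Finset.range n, (-x * ((r ^ 4) ^ (k + 1))⁻¹) =
      (-x) ^ (n : ℤ) * r ^ (-(2 * (n : ℤ) * (n + 1))) := by
  induction n with
  | zero => simp
  | succ n ih =>
    rw [Finset.prod_range_succ, ih, ← pow_mul, ← zpow_natCast, ← zpow_neg]
    have h1 : (-x) ^ ((n + 1 : ℕ) : ℤ) = (-x) ^ (n : ℤ) * (-x) := by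
      push_cast
      rw [zpow_add_one₀ (neg_ne_zero.2 hx)]
    have h2 : r ^ (-(2 * ((n + 1 : ℕ) : ℤ) * ((n + 1 : ℕ) + 1))) =
        r ^ (-(2 * (n : ℤ) * (n + 1))) * r ^ (-((4 * (n + 1) : ℕ) : ℤ)) := by
      rw [← zpow_add₀ hr]
      congr 1
      push_cast
      ring
    rw [h1, h2]
    ring

/-- This is the q-binomial theorem with 2n factors at z = -x p^{-n}. The last n factors are those of
(x;p)_n; the first n, read backwards, are monomials times those of (p/x;p)_n. -/
theorem finite_triple_product {r x : ℂ} (hr : r ≠ 0) (hx : x ≠ 0) (n : ℕ) :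
    (∏ k ∈ Finset.range n, (1 - x * (r ^ 4) ^ k)) *
        ∏ k ∈ Finset.range n, (1 - r ^ 4 / x * (r ^ 4) ^ k) =
      ∑ i ∈ Finset.range (2 * n + 1), gaussBinom (r ^ 4) (2 * n) i * thetaTerm r x (i - n) := by
  have hx' : -x ≠ 0 := neg_ne_zero.2 hx
  set p := r ^ 4 with hp
  have hp0 : p ≠ 0 := pow_ne_zero _ hr
  have key := prod_one_add_mul_pow p (-x * (p ^ n)⁻¹) (2 * n)
  rw [two_mul, Finset.prod_range_add, ← Finset.prod_range_reflect] at key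
  have e1 : ∏ k ∈ Finset.range n, (1 + -x * (p ^ n)⁻¹ * p ^ (n + k)) =
      ∏ k ∈ Finset.range n, (1 - x * p ^ k) :=
    Finset.prod_congr rfl fun k _ => by
      rw [pow_add]
      field_simp
      ring
  have e2 : ∏ k ∈ Finset.range n, (1 + -x * (p ^ n)⁻¹ * p ^ (n - 1 - k)) =
      (∏ k ∈ Finset.range n, (-x * (p ^ (k + 1))⁻¹)) *
        ∏ k ∈ Finset.range n, (1 - p / x * p ^ k) := by
    rw [← Finset.prod_mul_distrib]
    refine Finset.prod_congr rfl fun k hk => ?_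
    have hk' : k < n := Finset.mem_range.1 hk
    have : p ^ n = p ^ (n - 1 - k) * p ^ (k + 1) := by rw [← pow_add]; congr 1; omega
    rw [this, pow_succ]
    field_simp
    ring
  rw [e1, e2, hp, prod_neg_mul_zpow hr hx, ← hp] at key
  have hD : (-x) ^ (n : ℤ) * r ^ (-(2 * (n : ℤ) * (n + 1))) ≠ 0 :=
    mul_ne_zero (zpow_ne_zero _ hx') (zpow_ne_zero _ hr)
  refine mul_left_cancel₀ hD ?_
  rw [← two_mul] at key
  refine Eq.trans (by ring) (key.trans ?_)
  rw [Finset.mul_sum]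
  refine Finset.sum_congr rfl fun i _ => ?_
  have h1 : (-x * (p ^ n)⁻¹) ^ i = (-x) ^ (i : ℤ) * r ^ (-(4 * (n : ℤ) * i)) := by
    rw [mul_pow, hp, ← pow_mul, inv_pow, ← pow_mul, zpow_natCast, zpow_neg]
    congr 2
  have h2 : (-x) ^ (i : ℤ) = (-x) ^ (n : ℤ) * (-x) ^ ((i : ℤ) - n) := by
    rw [← zpow_add₀ hx']
    congr 1
    ring
  have h3 : r ^ (2 * (i : ℤ) * (i - 1)) * r ^ (-(4 * (n : ℤ) * i)) =
      r ^ (-(2 * (n : ℤ) * (n + 1))) * r ^ (2 * ((i : ℤ) - n) * ((i : ℤ) - n - 1)) := by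
    rw [← zpow_add₀ hr, ← zpow_add₀ hr]
    congr 1
    ring
  rw [h1, h2, thetaTerm, hp, pow_choose_two_eq_zpow hr]
  linear_combination gaussBinom (r ^ 4) (2 * n) i * (-x) ^ (n : ℤ) * (-x) ^ ((i : ℤ) - n) * h3

/-- The coefficients of the finite triple product, extended by zero. -/
noncomputable def tripleCoeff (p : ℂ) (n : ℕ) (j : ℤ) : ℂ :=
  if -(n : ℤ) ≤ j ∧ j ≤ n then gaussBinom p (2 * n) (j + n).toNat else 0

/-- Putting all the finite sums over the same index set ℤ prepares the passage to the limit by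
dominated convergence. -/
theorem sum_range_eq_tsum_tripleCoeff (p : ℂ) (n : ℕ) (f : ℤ → ℂ) :
    ∑ i ∈ Finset.range (2 * n + 1), gaussBinom p (2 * n) i * f (i - n) =
      ∑' j : ℤ, tripleCoeff p n j * f j := by
  rw [tsum_eq_sum (s := Finset.Icc (-(n : ℤ)) n)]
  · refine Finset.sum_bij (fun i _ => (i : ℤ) - n) ?_ ?_ ?_ ?_
    · intro i hi
      simp only [Finset.mem_range, Finset.mem_Icc] at hi ⊢
      omega
    · intro i _ j _ h
      simpa using h
    · intro j hj
      simp only [Finset.mem_Icc] at hj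
      exact ⟨(j + n).toNat, by simp only [Finset.mem_range]; omega, by omega⟩
    · intro i hi
      simp only [Finset.mem_range] at hi
      rw [tripleCoeff, if_pos (by omega)]
      simp
  · intro j hj
    rw [tripleCoeff, if_neg (by simpa using hj), zero_mul]

theorem eulerProd_eq_prod (p : ℂ) (m : ℕ) :
    eulerProd p m = ∏ k ∈ Finset.range m, (1 - p * p ^ k) :=
  Finset.prod_congr rfl fun k _ => by rw [pow_succ']

theorem tendsto_eulerProd {p : ℂ} (hp : ‖p‖ < 1) :
    Tendsto (eulerProd p) atTop (𝓝 (qProd p p)) := by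
  simpa only [← eulerProd_eq_prod] using tendsto_qProd hp p

theorem mul_pow_ne_one_of_norm_lt {p : ℂ} (hp : ‖p‖ < 1) (k : ℕ) : p * p ^ k ≠ 1 := by
  intro h
  have := congrArg norm h
  rw [← pow_succ', norm_pow, norm_one] at this
  exact absurd this (pow_lt_one₀ (norm_nonneg _) hp (by omega)).ne

theorem eulerProd_ne_zero {p : ℂ} (hp : ‖p‖ < 1) (m : ℕ) : eulerProd p m ≠ 0 := by
  rw [eulerProd_eq_prod]
  refine Finset.prod_ne_zero_iff.2 fun k _ h => mul_pow_ne_one_of_norm_lt hp k ?_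
  linear_combination -h

theorem qProd_self_ne_zero {p : ℂ} (hp : ‖p‖ < 1) : qProd p p ≠ 0 :=
  qProd_ne_zero hp (mul_pow_ne_one_of_norm_lt hp)

theorem gaussBinom_eq_div {p : ℂ} (hp : ‖p‖ < 1) {m j : ℕ} (h : j ≤ m) :
    gaussBinom p m j = eulerProd p m * ((eulerProd p j)⁻¹ * (eulerProd p (m - j))⁻¹) := by
  rw [← gaussBinom_mul_eulerProd p m j h]
  have h1 := eulerProd_ne_zero hp j
  have h2 := eulerProd_ne_zero hp (m - j)
  field_simp

/-- The sequence (p;p)_m has a nonzero limit, so it and its inverse are bounded; this supplies the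
dominating constant. -/
theorem exists_norm_tripleCoeff_le {p : ℂ} (hp : ‖p‖ < 1) :
    ∃ C : ℝ, ∀ n j, ‖tripleCoeff p n j‖ ≤ C := by
  obtain ⟨B, hB⟩ := (tendsto_eulerProd hp).norm.bddAbove_range
  obtain ⟨D, hD⟩ := ((tendsto_eulerProd hp).inv₀ (qProd_self_ne_zero hp)).norm.bddAbove_range
  have hB' : ∀ m, ‖eulerProd p m‖ ≤ B := fun m => hB ⟨m, rfl⟩
  have hD' : ∀ m, ‖(eulerProd p m)⁻¹‖ ≤ D := fun m => hD ⟨m, rfl⟩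
  have hB0 : 0 ≤ B := (norm_nonneg _).trans (hB' 0)
  have hD0 : 0 ≤ D := (norm_nonneg _).trans (hD' 0)
  refine ⟨B * (D * D), fun n j => ?_⟩
  rw [tripleCoeff]
  split_ifs with h
  · rw [gaussBinom_eq_div hp (by omega), norm_mul, norm_mul]
    have := hB' (2 * n)
    have := hD' (j + n).toNat
    have := hD' (2 * n - (j + n).toNat)
    gcongr
  · rw [norm_zero]
    positivity

theorem tendsto_tripleCoeff {p : ℂ} (hp : ‖p‖ < 1) (j : ℤ) :
    Tendsto (fun n => tripleCoeff p n j) atTop (𝓝 (qProd p p)⁻¹) := by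
  have h0 := qProd_self_ne_zero hp
  have hE := tendsto_eulerProd hp
  have t1 : Tendsto (fun n : ℕ => 2 * n) atTop atTop :=
    tendsto_atTop_mono (fun n => by simp only [id]; omega) tendsto_id
  have t2 : Tendsto (fun n : ℕ => (j + n).toNat) atTop atTop := by
    refine tendsto_atTop.2 fun b => ?_
    filter_upwards [eventually_ge_atTop (b + j.natAbs)] with n hn
    omega
  have t3 : Tendsto (fun n : ℕ => 2 * n - (j + n).toNat) atTop atTop := by
    refine tendsto_atTop.2 fun b => ?_
    filter_upwards [eventually_ge_atTop (b + j.natAbs)] with n hn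
    omega
  have h := (hE.comp t1).mul (((hE.comp t2).inv₀ h0).mul ((hE.comp t3).inv₀ h0))
  rw [show qProd p p * ((qProd p p)⁻¹ * (qProd p p)⁻¹) = (qProd p p)⁻¹ by field_simp] at h
  refine h.congr' ?_
  filter_upwards [eventually_ge_atTop j.natAbs] with n hn
  rw [tripleCoeff, if_pos (by omega), gaussBinom_eq_div hp (by omega)]
  rfl

theorem summable_zpow_sq_mul {r x : ℂ} (hr0 : r ≠ 0) (hr : ‖r‖ < 1) (hx : x ≠ 0) :
    Summable fun j : ℤ => r ^ (j ^ 2) * x ^ j := by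
  set τ : ℂ := Complex.log r / (Real.pi * Complex.I) with hτ
  set z : ℂ := Complex.log x / (2 * Real.pi * Complex.I) with hz
  have hpi : (Real.pi : ℂ) ≠ 0 := by exact_mod_cast Real.pi_ne_zero
  have h1 : Real.pi * Complex.I * τ = Complex.log r := by
    rw [hτ]; field_simp
  have h2 : 2 * Real.pi * Complex.I * z = Complex.log x := by
    rw [hz]; field_simp
  -- With r = e^{πiτ} and x = e^{2πiz} the series is Jacobi's two-variable theta series, and |r| < 1
  -- says that τ lies in the upper half plane.
  have him : 0 < τ.im := by
    have h3 : (Real.pi * Complex.I * τ).re = Real.log ‖r‖ := by rw [h1, Complex.log_re]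
    have h4 : (Real.pi * Complex.I * τ).re = -(Real.pi * τ.im) := by simp
    have h5 : Real.log ‖r‖ < 0 := Real.log_neg (norm_pos_iff.2 hr0) hr
    nlinarith [Real.pi_pos]
  refine ((summable_jacobiTheta₂_term_iff z τ).2 him).congr fun j => ?_
  have e1 : x ^ j = Complex.exp (j * Complex.log x) := by
    rw [Complex.exp_int_mul, Complex.exp_log hx]
  have e2 : r ^ (j ^ 2) = Complex.exp ((j ^ 2 : ℤ) * Complex.log r) := by
    rw [Complex.exp_int_mul, Complex.exp_log hr0]
  rw [jacobiTheta₂_term, e1, e2, ← Complex.exp_add, ← h1, ← h2]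
  congr 1
  push_cast
  ring

theorem thetaTerm_eq {r : ℂ} (hr : r ≠ 0) (x : ℂ) (j : ℤ) :
    thetaTerm r x j = (r ^ 2) ^ (j ^ 2) * (-x * (r ^ 2)⁻¹) ^ j := by
  rw [thetaTerm, mul_zpow, inv_zpow', ← zpow_natCast r 2, ← zpow_mul, ← zpow_mul]
  have : r ^ (2 * j * (j - 1)) = r ^ ((2 : ℕ) * j ^ 2 : ℤ) * r ^ ((2 : ℕ) * -j : ℤ) := by
    rw [← zpow_add₀ hr]
    congr 1
    push_cast
    ring
  rw [this]
  ring

theorem summable_thetaTerm {r x : ℂ} (hr0 : r ≠ 0) (hr : ‖r‖ < 1) (hx : x ≠ 0) :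
    Summable (thetaTerm r x) := by
  have h2 : ‖r ^ 2‖ < 1 := by
    rw [norm_pow]
    exact pow_lt_one₀ (norm_nonneg _) hr (by norm_num)
  have hx' : -x * (r ^ 2)⁻¹ ≠ 0 :=
    mul_ne_zero (neg_ne_zero.2 hx) (inv_ne_zero (pow_ne_zero _ hr0))
  exact (summable_zpow_sq_mul (pow_ne_zero 2 hr0) h2 hx').congr fun j =>
    (thetaTerm_eq hr0 x j).symm

/-- The Jacobi triple product identity. -/
theorem jacobi_triple_product {r x : ℂ} (hr0 : r ≠ 0) (hr : ‖r‖ < 1) (hx : x ≠ 0) :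
    qProd (r ^ 4) (r ^ 4) * ellE x (r ^ 4) = ∑' j : ℤ, thetaTerm r x j := by
  have hp : ‖r ^ 4‖ < 1 := by
    rw [norm_pow]
    exact pow_lt_one₀ (norm_nonneg _) hr (by norm_num)
  have h1 : Tendsto (fun n : ℕ => ∑' j : ℤ, tripleCoeff (r ^ 4) n j * thetaTerm r x j) atTop
      (𝓝 (ellE x (r ^ 4))) := by
    refine ((tendsto_qProd hp x).mul (tendsto_qProd hp (r ^ 4 / x))).congr fun n => ?_
    rw [finite_triple_product hr0 hx, sum_range_eq_tsum_tripleCoeff]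
  obtain ⟨C, hC⟩ := exists_norm_tripleCoeff_le hp
  have h2 : Tendsto (fun n : ℕ => ∑' j : ℤ, tripleCoeff (r ^ 4) n j * thetaTerm r x j) atTop
      (𝓝 (∑' j : ℤ, (qProd (r ^ 4) (r ^ 4))⁻¹ * thetaTerm r x j)) := by
    refine tendsto_tsum_of_dominated_convergence
      ((summable_thetaTerm hr0 hr hx).norm.mul_left C)
      (fun j => (tendsto_tripleCoeff hp j).mul_const _) (Eventually.of_forall fun n j => ?_)
    rw [norm_mul]
    exact mul_le_mul_of_nonneg_right (hC n j) (norm_nonneg _)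
  have h3 := tendsto_nhds_unique h1 h2
  rw [tsum_mul_left] at h3
  rw [h3, mul_inv_cancel_left₀ (qProd_self_ne_zero hp)]

/-! ### The product formula for two theta functions and Weierstrass' identity -/

/-- The bilateral series `∑ r^{s²} x^s`. -/
noncomputable def gaussSeries (r x : ℂ) : ℂ := ∑' s : ℤ, r ^ (s ^ 2) * x ^ s

theorem tsum_shifted_gaussSeries {r x : ℂ} (hr0 : r ≠ 0) (hx : x ≠ 0) :
    ∑' s : ℤ, x ^ s * r ^ (s ^ 2 - 2 * s) = x / r * gaussSeries r x := by
  rw [gaussSeries, ← tsum_mul_left,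
    ← (Equiv.subRight (1 : ℤ)).tsum_eq fun s : ℤ => x / r * (r ^ (s ^ 2) * x ^ s)]
  refine tsum_congr fun s => ?_
  simp only [Equiv.subRight_apply]
  have h1 : r ^ (s ^ 2 - 2 * s) = r ^ ((s - 1) ^ 2) * r⁻¹ := by
    rw [← zpow_sub_one₀ hr0]
    congr 1
    ring
  have h2 : x ^ s = x ^ (s - 1) * x := by
    rw [← zpow_add_one₀ hx]
    congr 1
    ring
  rw [h1, h2]
  field_simp

/-- The pairs (k + l, k - l) are exactly the pairs (s, t) of equal parity, and (1 + (-1)^{s+t})/2 is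
the indicator of equal parity. -/
theorem tsum_same_parity {A B : ℤ → ℂ} (hA : Summable A) (hB : Summable B)
    (hA' : Summable fun s => (-1) ^ s * A s) (hB' : Summable fun s => (-1) ^ s * B s) :
    ∑' z : ℤ × ℤ, A (z.1 + z.2) * B (z.1 - z.2) =
      ((∑' s, A s) * (∑' t, B t) +
        (∑' s : ℤ, (-1) ^ s * A s) * ∑' t : ℤ, (-1) ^ t * B t) / 2 := by
  have hsgn : ∀ m : ℤ, (-1 : ℂ) ^ m * (-1) ^ m = 1 := fun m => by
    rw [← mul_zpow]
    simp
  set f : ℤ × ℤ → ℂ := fun w =>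
    (A w.1 * B w.2 + (-1) ^ w.1 * A w.1 * ((-1) ^ w.2 * B w.2)) / 2 with hf
  have hinj : Function.Injective fun z : ℤ × ℤ => (z.1 + z.2, z.1 - z.2) := by
    rintro ⟨a, b⟩ ⟨c, d⟩ h
    simp only [Prod.mk.injEq] at h ⊢
    omega
  have hsupp : Function.support f ⊆ Set.range fun z : ℤ × ℤ => (z.1 + z.2, z.1 - z.2) := by
    rintro ⟨s, t⟩ hst
    rcases Int.even_or_odd (s + t) with ⟨m, hm⟩ | ⟨m, hm⟩
    · exact ⟨(m, s - m), by simp only [Prod.mk.injEq]; omega⟩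
    · refine absurd ?_ hst
      have ht : t = 2 * m + 1 - s := by omega
      have : (-1 : ℂ) ^ t = -(-1) ^ s := by
        rw [ht, sub_eq_add_neg, zpow_add₀ (by norm_num), zpow_add₀ (by norm_num), zpow_mul,
          zpow_neg, ← inv_zpow]
        norm_num
      simp only [hf, this]
      linear_combination -(1 / 2) * A s * B t * hsgn s
  have h1 := hinj.tsum_eq hsupp
  have h2 : ∀ z : ℤ × ℤ, f (z.1 + z.2, z.1 - z.2) = A (z.1 + z.2) * B (z.1 - z.2) := by
    rintro ⟨k, l⟩
    have : (-1 : ℂ) ^ (k + l) * (-1) ^ (k - l) = 1 := by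
      rw [← zpow_add₀ (by norm_num), show k + l + (k - l) = k + k by ring,
        zpow_add₀ (by norm_num), hsgn]
    simp only [hf]
    linear_combination 1 / 2 * A (k + l) * B (k - l) * this
  rw [tsum_congr h2] at h1
  have s1 := summable_mul_of_summable_norm hA.norm hB.norm
  have s2 := summable_mul_of_summable_norm hA'.norm hB'.norm
  have h3 : ∑' w, f w = (∑' w : ℤ × ℤ, (A w.1 * B w.2 +
      (-1) ^ w.1 * A w.1 * ((-1) ^ w.2 * B w.2))) / 2 := tsum_div_const
  rw [h1, h3, s1.tsum_add s2, tsum_mul_tsum_of_summable_norm hA.norm hB.norm,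
    tsum_mul_tsum_of_summable_norm hA'.norm hB'.norm]

theorem neg_one_zpow_mul_zpow (x : ℂ) (s : ℤ) : (-1) ^ s * x ^ s = (-x) ^ s := by
  rw [← mul_zpow, neg_one_mul]

/-- Up to the factor x, the product becomes a determinant in the vectors (G(x), G(-x)) and (G(y),
G(-y)), which is what makes the three-term identity algebraic. -/
theorem ellE_mul_ellE_div {r x y : ℂ} (hr0 : r ≠ 0) (hr : ‖r‖ < 1) (hx : x ≠ 0) (hy : y ≠ 0) :
    qProd (r ^ 4) (r ^ 4) ^ 2 * (ellE (x * y) (r ^ 4) * ellE (x / y) (r ^ 4)) =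
      x / (2 * r) * (gaussSeries r x * gaussSeries r (-y) -
        gaussSeries r (-x) * gaussSeries r y) := by
  have hS : ∀ {u : ℂ}, u ≠ 0 → Summable fun s : ℤ => u ^ s * r ^ (s ^ 2 - 2 * s) := fun {u} hu => by
    refine (summable_zpow_sq_mul hr0 hr (x := u * (r ^ 2)⁻¹)
      (mul_ne_zero hu (inv_ne_zero (pow_ne_zero _ hr0)))).congr fun s => ?_
    rw [mul_zpow, inv_zpow', ← zpow_natCast r 2, ← zpow_mul]
    have : r ^ (s ^ 2 - 2 * s) = r ^ (s ^ 2) * r ^ ((2 : ℕ) * -s : ℤ) := by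
      rw [← zpow_add₀ hr0]
      congr 1
      push_cast
      ring
    rw [this]
    ring
  have hx' := neg_ne_zero.2 hx
  have hy' := neg_ne_zero.2 hy
  have e1 : (fun s : ℤ => (-1) ^ s * ((-x) ^ s * r ^ (s ^ 2 - 2 * s))) =
      fun s : ℤ => x ^ s * r ^ (s ^ 2 - 2 * s) := by
    funext s
    rw [← mul_assoc, neg_one_zpow_mul_zpow, neg_neg]
  have e2 : (fun s : ℤ => (-1) ^ s * (r ^ (s ^ 2) * y ^ s)) =
      fun s : ℤ => r ^ (s ^ 2) * (-y) ^ s := by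
    funext s
    rw [← neg_one_zpow_mul_zpow y]
    ring
  have h := tsum_same_parity (hS hx') (summable_zpow_sq_mul hr0 hr hy)
    (by rw [e1]; exact hS hx) (by rw [e2]; exact summable_zpow_sq_mul hr0 hr hy')
  rw [e1, e2, tsum_shifted_gaussSeries hr0 hx', tsum_shifted_gaussSeries hr0 hx] at h
  -- The quadratic exponents separate because 2k(k-1) + 2l(l-1) = (k+l)² - 2(k+l) + (k-l)². Taking p
  -- = r^4 keeps all these exponents integral.
  have hterm : ∀ z : ℤ × ℤ, thetaTerm r (x * y) z.1 * thetaTerm r (x / y) z.2 =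
      (-x) ^ (z.1 + z.2) * r ^ ((z.1 + z.2) ^ 2 - 2 * (z.1 + z.2)) *
        (r ^ ((z.1 - z.2) ^ 2) * y ^ (z.1 - z.2)) := by
    rintro ⟨k, l⟩
    simp only [thetaTerm]
    have a1 : -(x * y) = -x * y := by ring
    have a2 : -(x / y) = -x * y⁻¹ := by ring
    have a3 : r ^ (2 * k * (k - 1)) * r ^ (2 * l * (l - 1)) =
        r ^ ((k + l) ^ 2 - 2 * (k + l)) * r ^ ((k - l) ^ 2) := by
      rw [← zpow_add₀ hr0, ← zpow_add₀ hr0]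
      congr 1
      ring
    rw [a1, a2, mul_zpow, mul_zpow, zpow_add₀ hx', sub_eq_add_neg k l, zpow_add₀ hy, inv_zpow',
      ← sub_eq_add_neg]
    linear_combination (-x) ^ k * (-x) ^ l * y ^ k * y ^ (-l) * a3
  have hxy := mul_ne_zero hx hy
  have hxy' := div_ne_zero hx hy
  calc _ = (qProd (r ^ 4) (r ^ 4) * ellE (x * y) (r ^ 4)) *
        (qProd (r ^ 4) (r ^ 4) * ellE (x / y) (r ^ 4)) := by ring
    _ = _ := by
      rw [jacobi_triple_product hr0 hr hxy, jacobi_triple_product hr0 hr hxy',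
        tsum_mul_tsum_of_summable_norm (summable_thetaTerm hr0 hr hxy).norm
          (summable_thetaTerm hr0 hr hxy').norm, tsum_congr hterm, h]
      simp only [gaussSeries]
      field_simp
      ring

theorem ellE_zero (x : ℂ) : ellE x 0 = 1 - x := by
  have h : ∀ y : ℂ, qProd 0 y = 1 - y := fun y => by
    rw [qProd, tprod_eq_mulSingle 0]
    · simp
    · intro k hk
      simp [hk]
  rw [ellE_eq_qProd, h, h]
  simp

/-- Weierstrass' three-term identity for the theta function. -/
theorem ellE_three_term {p : ℂ} (hp : ‖p‖ < 1) {x y u v : ℂ} (hx : x ≠ 0) (hy : y ≠ 0)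
    (hu : u ≠ 0) (hv : v ≠ 0) :
    ellE (x * y) p * ellE (x / y) p * (ellE (u * v) p * ellE (u / v) p) -
      ellE (x * v) p * ellE (x / v) p * (ellE (u * y) p * ellE (u / y) p) =
      u / y * (ellE (x * u) p * ellE (x / u) p * (ellE (y * v) p * ellE (y / v) p)) := by
  -- The bilateral series needs an invertible r, so p = 0 is treated apart; there E(x) = 1 - x and
  -- the identity is rational.
  rcases eq_or_ne p 0 with rfl | hp0
  · simp only [ellE_zero]
    field_simp
    ring
  · obtain ⟨r, rfl⟩ : ∃ r : ℂ, r ^ 4 = p := IsAlgClosed.exists_pow_nat_eq p (by norm_num)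
    have hr0 : r ≠ 0 := by
      rintro rfl
      simp at hp0
    have hr : ‖r‖ < 1 := by
      rw [norm_pow] at hp
      exact (pow_lt_one_iff_of_nonneg (norm_nonneg r) (by norm_num)).1 hp
    have hK := qProd_self_ne_zero hp
    have h1 : ∀ {s t : ℂ}, s ≠ 0 → t ≠ 0 → ellE (s * t) (r ^ 4) * ellE (s / t) (r ^ 4) =
        s / (2 * r * qProd (r ^ 4) (r ^ 4) ^ 2) * (gaussSeries r s * gaussSeries r (-t) -
          gaussSeries r (-s) * gaussSeries r t) := fun {s t} hs ht => by
      have := ellE_mul_ellE_div hr0 hr hs ht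
      field_simp at this ⊢
      linear_combination this
    -- After this substitution only the Plücker relation between 2×2 minors is left.
    rw [h1 hx hy, h1 hu hv, h1 hx hv, h1 hu hy, h1 hx hu, h1 hy hv]
    field_simp
    ring

/-! ### The odd theta function in additive notation -/

/-- The theta function in additive notation, normalised to be odd. -/
noncomputable def oddTheta (p u : ℂ) : ℂ := Complex.exp (-u / 2) * ellE (Complex.exp u) p

theorem ellE_exp (p u : ℂ) : ellE (Complex.exp u) p = Complex.exp (u / 2) * oddTheta p u := by
  rw [oddTheta, ← mul_assoc, ← Complex.exp_add]
  simp [neg_div]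

/-- The inversion E(1/x) = -E(x)/x follows by splitting the first factor off each infinite product;
the factor e^{-u/2} symmetrises it. -/
theorem oddTheta_neg {p : ℂ} (hp : ‖p‖ < 1) (u : ℂ) : oddTheta p (-u) = -oddTheta p u := by
  have hx := Complex.exp_ne_zero u
  have h1 := qProd_eq_mul hp (Complex.exp u)
  have h2 := qProd_eq_mul hp (Complex.exp u)⁻¹
  have h3 : Complex.exp (-(-u) / 2) = Complex.exp (-u / 2) * Complex.exp u := by
    rw [← Complex.exp_add]
    congr 1
    ring
  rw [oddTheta, oddTheta, ellE_eq_qProd, ellE_eq_qProd, h3, Complex.exp_neg, h2, h1, div_inv_eq_mul,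
    div_eq_mul_inv p]
  field_simp
  ring

theorem continuous_oddTheta {p : ℂ} (hp : ‖p‖ < 1) : Continuous (oddTheta p) := by
  have h := continuous_qProd hp
  have h1 : Continuous fun u : ℂ => qProd p (Complex.exp u) := h.comp Complex.continuous_exp
  have h2 : Continuous fun u : ℂ => qProd p (p / Complex.exp u) :=
    h.comp (continuous_const.div Complex.continuous_exp Complex.exp_ne_zero)
  have h3 : Continuous fun u : ℂ => Complex.exp (-u / 2) := by fun_prop
  exact h3.mul (h1.mul h2)

theorem oddTheta_three_term {p : ℂ} (hp : ‖p‖ < 1) (x y u v : ℂ) :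
    oddTheta p (x + y) * oddTheta p (x - y) * (oddTheta p (u + v) * oddTheta p (u - v)) -
      oddTheta p (x + v) * oddTheta p (x - v) * (oddTheta p (u + y) * oddTheta p (u - y)) =
      oddTheta p (x + u) * oddTheta p (x - u) * (oddTheta p (y + v) * oddTheta p (y - v)) := by
  have h := ellE_three_term hp (Complex.exp_ne_zero x) (Complex.exp_ne_zero y)
    (Complex.exp_ne_zero u) (Complex.exp_ne_zero v)
  simp only [← Complex.exp_add, ← Complex.exp_sub] at h
  have hp2 : ∀ s t : ℂ, oddTheta p (s + t) * oddTheta p (s - t) =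
      Complex.exp (-s) * (ellE (Complex.exp (s + t)) p * ellE (Complex.exp (s - t)) p) := by
    intro s t
    have : Complex.exp (-s) = Complex.exp (-(s + t) / 2) * Complex.exp (-(s - t) / 2) := by
      rw [← Complex.exp_add]
      congr 1
      ring
    rw [oddTheta, oddTheta, this]
    ring
  rw [hp2 x y, hp2 u v, hp2 x v, hp2 u y, hp2 x u, hp2 y v]
  have he : Complex.exp (-u) * Complex.exp (u - y) = Complex.exp (-y) := by
    rw [← Complex.exp_add]
    congr 1
    ring
  rw [← he]
  linear_combination Complex.exp (-x) * Complex.exp (-u) * h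

/-- A zero forces some factor of one of the two products to vanish, so e^u is p^{-k} or p^{k+1}; a
countable set has countable preimage under the exponential. -/
theorem countable_oddTheta_eq_zero {p : ℂ} (hp : ‖p‖ < 1) : {u | oddTheta p u = 0}.Countable := by
  have hZ : (Set.range (fun k : ℕ => (p ^ k)⁻¹) ∪ Set.range fun k : ℕ => p * p ^ k).Countable :=
    (Set.countable_range _).union (Set.countable_range _)
  refine (hZ.preimage_cexp).mono fun u hu => ?_
  rw [Set.mem_ofPred_eq, oddTheta, mul_eq_zero, or_iff_right (Complex.exp_ne_zero _), ellE_eq_qProd,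
    mul_eq_zero] at hu
  have hx := Complex.exp_ne_zero u
  rcases hu with hu | hu
  · by_contra hcon
    refine qProd_ne_zero hp (fun k hk => hcon (Or.inl ⟨k, ?_⟩)) hu
    exact (eq_inv_of_mul_eq_one_left hk).symm
  · by_contra hcon
    refine qProd_ne_zero hp (fun k hk => hcon (Or.inr ⟨k, ?_⟩)) hu
    field_simp at hk
    exact hk

theorem countable_oddTheta_affine_eq_zero {p : ℂ} (hp : ‖p‖ < 1) (c : ℂ) {w : ℂ} (hw : w ≠ 0) :
    {t | oddTheta p (c + t * w) = 0}.Countable :=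
  (countable_oddTheta_eq_zero hp).preimage_of_injOn (f := fun t => c + t * w)
    (fun _ _ _ _ h => mul_right_cancel₀ hw (add_left_cancel h))

/-! ### The Frenkel–Turaev summation in additive notation -/

/-- An odd function satisfying the three-term identity of the theta function. -/
structure IsOddTheta (s : ℂ → ℂ) : Prop where
  neg : ∀ u, s (-u) = -s u
  three_term : ∀ x y u v, s (x + y) * s (x - y) * (s (u + v) * s (u - v)) -
    s (x + v) * s (x - v) * (s (u + y) * s (u - y)) =
    s (x + u) * s (x - u) * (s (y + v) * s (y - v))

theorem IsOddTheta.zero {s : ℂ → ℂ} (hs : IsOddTheta s) : s 0 = 0 := by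
  have h := hs.neg 0
  rw [neg_zero] at h
  linear_combination h / 2

/-- The twelve arguments are free up to provable equality, so that an instance can be stated in the
form in which it is used. -/
theorem IsOddTheta.three_term_of {s : ℂ → ℂ} (hs : IsOddTheta s) (x y u v : ℂ)
    {a₁ a₂ a₃ a₄ b₁ b₂ b₃ b₄ c₁ c₂ c₃ c₄ : ℂ} (ha₁ : a₁ = x + y) (ha₂ : a₂ = x - y)
    (ha₃ : a₃ = u + v) (ha₄ : a₄ = u - v) (hb₁ : b₁ = x + v) (hb₂ : b₂ = x - v)
    (hb₃ : b₃ = u + y) (hb₄ : b₄ = u - y) (hc₁ : c₁ = x + u) (hc₂ : c₂ = x - u)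
    (hc₃ : c₃ = y + v) (hc₄ : c₄ = y - v) :
    s a₁ * s a₂ * (s a₃ * s a₄) - s b₁ * s b₂ * (s b₃ * s b₄) =
      s c₁ * s c₂ * (s c₃ * s c₄) := by
  subst_vars
  exact hs.three_term x y u v

/-- The shifted factorial `s(x) s(x+h) ⋯ s(x+(k-1)h)`. -/
noncomputable def addFac (s : ℂ → ℂ) (h x : ℂ) (k : ℕ) : ℂ :=
  ∏ i ∈ Finset.range k, s (x + i * h)

@[simp] theorem addFac_zero (s : ℂ → ℂ) (h x : ℂ) : addFac s h x 0 = 1 := by simp [addFac]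

theorem addFac_succ_left (s : ℂ → ℂ) {h x y : ℂ} (k : ℕ) (hy : y = x + h) :
    addFac s h x (k + 1) = s x * addFac s h y k := by
  rw [addFac, Finset.prod_range_succ', mul_comm, hy, addFac]
  congr 1
  · simp
  · refine Finset.prod_congr rfl fun i _ => ?_
    congr 1
    push_cast
    ring

theorem addFac_succ_right (s : ℂ → ℂ) {h x y : ℂ} (k : ℕ) (hy : y = x + k * h) :
    addFac s h x (k + 1) = addFac s h x k * s y := by
  rw [addFac, Finset.prod_range_succ, hy, addFac]

theorem addFac_mul_right (s : ℂ → ℂ) {h x y z : ℂ} (k : ℕ) (hy : y = x + h) (hz : z = x + k * h) :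
    addFac s h x k * s z = s x * addFac s h y k := by
  rw [← addFac_succ_right s k hz, addFac_succ_left s k hy]

/-- The argument `x` avoids all zeros of `s` modulo multiples of `h`. -/
def Generic (s : ℂ → ℂ) (h x : ℂ) : Prop := ∀ m : ℤ, s (x + m * h) ≠ 0

theorem Generic.ne {s : ℂ → ℂ} {h x : ℂ} (hx : Generic s h x) {y : ℂ} (m : ℤ)
    (hy : y = x + m * h) : s y ≠ 0 := hy ▸ hx m

theorem Generic.shift {s : ℂ → ℂ} {h x : ℂ} (hx : Generic s h x) {y : ℂ} (m : ℤ)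
    (hy : y = x + m * h) : Generic s h y := fun k =>
  hx.ne (m + k) (by rw [hy]; push_cast; ring)

theorem Generic.addFac_ne {s : ℂ → ℂ} {h x : ℂ} (hx : Generic s h x) {y : ℂ} (m : ℤ) (k : ℕ)
    (hy : y = x + m * h) : addFac s h y k ≠ 0 :=
  Finset.prod_ne_zero_iff.2 fun i _ => hx.ne (m + i) (by rw [hy]; push_cast; ring)

/-- The terms of the Frenkel–Turaev sum. -/
noncomputable def ftTerm (s : ℂ → ℂ) (h : ℂ) (n : ℕ) (a b c d e : ℂ) (k : ℕ) : ℂ :=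
  s (a + 2 * k * h) / s a *
    ((addFac s h a k * addFac s h b k * addFac s h c k * addFac s h d k * addFac s h e k *
      addFac s h (-n * h) k) /
    (addFac s h h k * addFac s h (a + h - b) k * addFac s h (a + h - c) k *
      addFac s h (a + h - d) k * addFac s h (a + h - e) k * addFac s h (a + (n + 1) * h) k))

/-- The value of the Frenkel–Turaev sum. -/
noncomputable def ftValue (s : ℂ → ℂ) (h : ℂ) (n : ℕ) (a b c d : ℂ) : ℂ :=
  addFac s h (a + h) n * addFac s h (a + h - b - c) n * addFac s h (a + h - b - d) n *
      addFac s h (a + h - c - d) n /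
    (addFac s h (a + h - b) n * addFac s h (a + h - c) n * addFac s h (a + h - d) n *
      addFac s h (a + h - b - c - d) n)

/-- The coefficient in the contiguous relation for the Frenkel–Turaev sum. -/
noncomputable def ftCoeff (s : ℂ → ℂ) (h : ℂ) (n : ℕ) (a b c d e : ℂ) : ℂ :=
  s (a + 2 * h) * s (a + h) * s b * s c * s d * (s (e + n * h) * s (e - (n + 2) * h - a)) /
    (s (a + h - b) * s (a + h - c) * s (a + h - d) * (s (a + h - e) * s (a + 2 * h - e)) *
      (s (a + (n + 1) * h) * s (a + (n + 2) * h)))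

section

variable {s : ℂ → ℂ} {h : ℂ}

theorem addFac_mul_self_ne (h0 : ∀ m : ℤ, m ≠ 0 → s (m * h) ≠ 0) (k : ℕ) : addFac s h h k ≠ 0 :=
  Finset.prod_ne_zero_iff.2 fun i _ => by
    have := h0 (1 + i) (by omega)
    push_cast at this
    rwa [add_mul, one_mul] at this

/-- The three terms share all but a few factors, and the few that differ are related by one
three-term identity. No balancing condition enters here. Both terms on the right have length n,
which drives the induction. -/
theorem ftTerm_succ (hs : IsOddTheta s) (h0 : ∀ m : ℤ, m ≠ 0 → s (m * h) ≠ 0) (n : ℕ)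
    {a b c d e : ℂ} (ha : Generic s h a) (hb : Generic s h (a - b)) (hc : Generic s h (a - c))
    (hd : Generic s h (a - d)) (he : Generic s h (a - e)) (i : ℕ) :
    ftTerm s h (n + 1) a b c d e (i + 1) = ftTerm s h n a b c d (e - h) (i + 1) +
      ftCoeff s h n a b c d e * ftTerm s h n (a + 2 * h) (b + h) (c + h) (d + h) e i := by
  -- The halves of a come from solving for x, y, u, v in terms of the prescribed sums and
  -- differences.
  have q1 : s (e + i * h) * s (a + (i + 2) * h - e) * (s (a + (n + 1) * h) * s (-(n + 1) * h)) -
      s (a + (n + 2 + i) * h) * s ((i - n) * h) * (s (e - h) * s (a + h - e)) =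
      s (a + (i + 1) * h) * s ((i + 1) * h) * (s (e + n * h) * s (e - (n + 2) * h - a)) :=
    hs.three_term_of (a / 2 + (i + 1) * h) (e - h - a / 2) (a / 2) (a / 2 + (n + 1) * h)
      (by ring) (by ring) (by ring) (by ring) (by ring) (by ring) (by ring) (by ring) (by ring)
      (by ring) (by ring) (by ring)
  unfold ftTerm ftCoeff
  rw [show ((n + 1 : ℕ) : ℂ) = (n : ℂ) + 1 by push_cast; ring,
    show ((i + 1 : ℕ) : ℂ) = (i : ℂ) + 1 by push_cast; ring]
  rw [show a + h - (e - h) = a + 2 * h - e by ring,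
    show a + (n + 1 + 1) * h = a + (n + 2) * h by ring,
    show a + 2 * h + h - (b + h) = a + 2 * h - b by ring,
    show a + 2 * h + h - (c + h) = a + 2 * h - c by ring,
    show a + 2 * h + h - (d + h) = a + 2 * h - d by ring,
    show a + 2 * h + h - e = a + 3 * h - e by ring,
    show a + 2 * h + (n + 1) * h = a + (n + 3) * h by ring,
    show a + 2 * h + 2 * i * h = a + 2 * (i + 1) * h by ring]
  have e1 : addFac s h a (i + 1) = s a * s (a + h) * addFac s h (a + 2 * h) i /
      s (a + (i + 1) * h) := by
    rw [eq_div_iff (ha.ne (i + 1) (by push_cast; ring)),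
      addFac_succ_left s (y := a + h) i rfl, mul_assoc,
      addFac_mul_right s i (y := a + 2 * h) (by ring) (by ring)]
    ring
  have e2 : addFac s h (a + 2 * h - e) i = s (a + 2 * h - e) * addFac s h (a + 3 * h - e) i /
      s (a + (i + 2) * h - e) := by
    rw [eq_div_iff (he.ne (i + 2) (by push_cast; ring)),
      addFac_mul_right s i (y := a + 3 * h - e) (by ring) (by ring)]
  have e3 : addFac s h (a + (n + 2) * h) i = s (a + (n + 2) * h) * addFac s h (a + (n + 3) * h) i /
      s (a + (n + 2 + i) * h) := by
    rw [eq_div_iff (ha.ne (n + 2 + i) (by push_cast; ring)),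
      addFac_mul_right s i (y := a + (n + 3) * h) (by ring) (by ring)]
  rw [e1, addFac_succ_left s (x := b) (y := b + h) i rfl,
    addFac_succ_left s (x := c) (y := c + h) i rfl,
    addFac_succ_left s (x := d) (y := d + h) i rfl,
    addFac_succ_left s (x := e - h) (y := e) i (by ring),
    addFac_succ_right s (x := e) i rfl,
    addFac_succ_left s (x := -((n : ℂ) + 1) * h) (y := -n * h) i (by ring),
    addFac_succ_right s (x := -n * h) (y := (i - n) * h) i (by ring),
    addFac_succ_right s (x := h) (y := (i + 1) * h) i (by ring),
    addFac_succ_left s (x := a + h - b) (y := a + 2 * h - b) i (by ring),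
    addFac_succ_left s (x := a + h - c) (y := a + 2 * h - c) i (by ring),
    addFac_succ_left s (x := a + h - d) (y := a + 2 * h - d) i (by ring),
    addFac_succ_left s (x := a + h - e) (y := a + 2 * h - e) i (by ring),
    addFac_succ_left s (x := a + 2 * h - e) (y := a + 3 * h - e) i (by ring),
    addFac_succ_left s (x := a + (n + 1) * h) (y := a + (n + 2) * h) i (by ring),
    addFac_succ_left s (x := a + (n + 2) * h) (y := a + (n + 3) * h) i (by ring), e2, e3]
  have n1 := ha.ne (y := a) 0 (by simp)
  have n2 := ha.ne (y := a + (i + 1) * h) (i + 1) (by push_cast; ring)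
  have n3 := addFac_mul_self_ne h0 i
  have n4 : s ((i + 1) * h) ≠ 0 := by simpa using h0 (i + 1) (by omega)
  have n5 := hb.ne (y := a + h - b) 1 (by push_cast; ring)
  have n6 := hc.ne (y := a + h - c) 1 (by push_cast; ring)
  have n7 := hd.ne (y := a + h - d) 1 (by push_cast; ring)
  have n8 := he.ne (y := a + h - e) 1 (by push_cast; ring)
  have n9 := he.ne (y := a + 2 * h - e) 2 (by push_cast; ring)
  have n10 := he.ne (y := a + (i + 2) * h - e) (i + 2) (by push_cast; ring)
  have n11 := ha.ne (y := a + (n + 1) * h) (n + 1) (by push_cast; ring)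
  have n12 := ha.ne (y := a + (n + 2) * h) (n + 2) (by push_cast; ring)
  have n13 := ha.ne (y := a + (n + 2 + i) * h) (n + 2 + i) (by push_cast; ring)
  have n15 : s (-((n : ℂ) + 1) * h) ≠ 0 := by
    have := h0 (-(n + 1)) (by omega)
    push_cast at this
    exact this
  have n14 := ha.ne (y := a + 2 * h) 2 (by push_cast; ring)
  have m1 := hb.addFac_ne (y := a + 2 * h - b) 2 i (by push_cast; ring)
  have m2 := hc.addFac_ne (y := a + 2 * h - c) 2 i (by push_cast; ring)
  have m3 := hd.addFac_ne (y := a + 2 * h - d) 2 i (by push_cast; ring)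
  have m4 := he.addFac_ne (y := a + 3 * h - e) 3 i (by push_cast; ring)
  have m5 := ha.addFac_ne (y := a + (n + 3) * h) (n + 3) i (by push_cast; ring)
  -- From here on the theta values are opaque atoms; only `q1` relates them.
  generalize s ((i + 1) * h) = z1 at *
  generalize s (a + (i + 1) * h) = z2 at *
  generalize s (a + (i + 2) * h - e) = z3 at *
  generalize s (a + (n + 1) * h) = z4 at *
  generalize s (a + (n + 2) * h) = z5 at *
  generalize s (a + (n + 2 + i) * h) = z6 at *
  generalize s ((i - n) * h) = z7 at *
  generalize s (-((n : ℂ) + 1) * h) = z8 at *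
  generalize s (e + i * h) = z9 at *
  generalize s (e - h) = z10 at *
  generalize s (a + h - e) = z11 at *
  generalize s (e + n * h) = z12 at *
  generalize s (e - (n + 2) * h - a) = z13 at *
  clear e1 e2 e3 ha hb hc hd he
  generalize s (a + 2 * h - e) = y1 at *
  generalize s (a + 2 * h) = y3 at *
  generalize addFac s h (a + (n + 3) * h) i = F at *
  generalize addFac s h (a + 3 * h - e) i = E' at *
  generalize s (a + 2 * (i + 1) * h) = A' at *
  generalize s (a + h - b) = B' at *
  generalize s (a + h - c) = C' at *
  generalize s (a + h - d) = D' at *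
  generalize s (a + h) = G' at *
  generalize addFac s h (a + 2 * h) i = H' at *
  generalize addFac s h (b + h) i = I' at *
  generalize addFac s h (c + h) i = J' at *
  generalize addFac s h (d + h) i = K' at *
  generalize addFac s h e i = L' at *
  generalize addFac s h (-n * h) i = M' at *
  generalize addFac s h h i = N' at *
  generalize addFac s h (a + 2 * h - b) i = O' at *
  generalize addFac s h (a + 2 * h - c) i = P' at *
  generalize addFac s h (a + 2 * h - d) i = Q' at *
  generalize s a = R' at *
  generalize s b = S' at *
  generalize s c = T' at *
  generalize s d = U' at *
  -- K is the common factor of the three terms, so the recursion is K times `q1` divided by z11 *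
  -- z4.
  set K := A' * G' * H' *
      (S' * I') * (T' * J') * (U' * K') *
      L' * M' /
    (z2 * z1 * N' * (B' * O') *
      (C' * P') *
      (D' * Q') * (y1 * E') * (z5 * F)) with hK
  have q2 : K * (z9 * z8 * z3 / z11) = K * (z10 * z7 * z6 / z4) +
      K * (z12 * z13 * z2 * z1 / (z11 * z4)) := by
    have : z9 * z8 * z3 / z11 = z10 * z7 * z6 / z4 + z12 * z13 * z2 * z1 / (z11 * z4) := by
      field_simp
      linear_combination q1
    rw [this, mul_add]
  refine Eq.trans ?_ (q2.trans (congrArg₂ (· + ·) ?_ ?_))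
  all_goals
    simp only [hK, mul_div_assoc', div_mul_eq_mul_div, div_div, div_div_eq_mul_div]
    rw [div_eq_div_iff (by repeat' first | assumption | apply mul_ne_zero)
      (by repeat' first | assumption | apply mul_ne_zero)]
    ring

/-- The closed form obeys the recursion of the sums. Here balancing is essential: it eliminates e,
after which dividing by the common factor leaves a single three-term identity. -/
theorem ftValue_succ (hs : IsOddTheta s) (n : ℕ) {a b c d e : ℂ} (ha : Generic s h a)
    (hb : Generic s h (a - b)) (hc : Generic s h (a - c)) (hd : Generic s h (a - d))
    (he : Generic s h (a - e)) (hbal : b + c + d + e = 2 * a + (n + 2) * h) :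
    ftValue s h (n + 1) a b c d = ftValue s h n a b c d +
      ftCoeff s h n a b c d e * ftValue s h n (a + 2 * h) (b + h) (c + h) (d + h) := by
  obtain rfl : e = 2 * a + (n + 2) * h - b - c - d := by linear_combination hbal
  have q1 : s (a + (n + 1) * h) * s (a + (n + 1) * h - b - c) *
        (s (a + (n + 1) * h - b - d) * s (a + (n + 1) * h - c - d)) -
      s (a + (n + 1) * h - b) * s (a + (n + 1) * h - c) *
        (s (a + (n + 1) * h - d) * s (a + (n + 1) * h - b - c - d)) =
      s (2 * a + (n + 2) * h - b - c - d + n * h) * s d * (s c * s b) :=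
    hs.three_term_of (a + (n + 1) * h - (b + c) / 2) ((b + c) / 2)
      (a + (n + 1) * h - (b + c) / 2 - d) ((c - b) / 2)
      (by ring) (by ring) (by ring) (by ring) (by ring) (by ring) (by ring) (by ring) (by ring)
      (by ring) (by ring) (by ring)
  unfold ftValue ftCoeff
  rw [show a + 2 * h + h - (b + h) - (c + h) = a + h - b - c by ring,
    show a + 2 * h + h - (b + h) - (d + h) = a + h - b - d by ring,
    show a + 2 * h + h - (c + h) - (d + h) = a + h - c - d by ring,
    show a + 2 * h + h - (b + h) = a + 2 * h - b by ring,
    show a + 2 * h + h - (c + h) = a + 2 * h - c by ring,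
    show a + 2 * h + h - (d + h) = a + 2 * h - d by ring,
    show a + h - b - c - (d + h) = a - b - c - d by ring,
    show a + h - (2 * a + (n + 2) * h - b - c - d) = -(a + (n + 1) * h - b - c - d) by ring,
    show a + 2 * h - (2 * a + (n + 2) * h - b - c - d) = -(a + n * h - b - c - d) by ring,
    show 2 * a + (n + 2) * h - b - c - d - (n + 2) * h - a = a - b - c - d by ring,
    hs.neg, hs.neg]
  have n1 := ha.ne (y := a + h) 1 (by push_cast; ring)
  have n2 := ha.ne (y := a + 2 * h) 2 (by push_cast; ring)
  have n3 := ha.ne (y := a + (n + 1) * h) (n + 1) (by push_cast; ring)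
  have n4 := ha.ne (y := a + (n + 2) * h) (n + 2) (by push_cast; ring)
  have n5 := hb.ne (y := a + h - b) 1 (by push_cast; ring)
  have n6 := hc.ne (y := a + h - c) 1 (by push_cast; ring)
  have n7 := hd.ne (y := a + h - d) 1 (by push_cast; ring)
  have n8 := hb.ne (y := a + (n + 1) * h - b) (n + 1) (by push_cast; ring)
  have n9 := hc.ne (y := a + (n + 1) * h - c) (n + 1) (by push_cast; ring)
  have n10 := hd.ne (y := a + (n + 1) * h - d) (n + 1) (by push_cast; ring)
  have hneg : ∀ {y : ℂ} (m : ℤ), y = -(a - (2 * a + (n + 2) * h - b - c - d) + m * h) →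
      s y ≠ 0 := fun {y} m hy => by
    rw [hy, hs.neg]
    exact neg_ne_zero.2 (he m)
  have n11 : s (a - b - c - d) ≠ 0 := hneg (n + 2) (by push_cast; ring)
  have n12 : s (a + n * h - b - c - d) ≠ 0 := hneg 2 (by push_cast; ring)
  have n13 : s (a + (n + 1) * h - b - c - d) ≠ 0 := hneg 1 (by push_cast; ring)
  have m1 := hb.addFac_ne (y := a + h - b) 1 n (by push_cast; ring)
  have m2 := hc.addFac_ne (y := a + h - c) 1 n (by push_cast; ring)
  have m3 := hd.addFac_ne (y := a + h - d) 1 n (by push_cast; ring)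
  have m4 : addFac s h (a + h - b - c - d) n ≠ 0 :=
    Finset.prod_ne_zero_iff.2 fun i _ => hneg (n + 1 - i) (by push_cast; ring)
  have e1 : addFac s h (a + 2 * h + h) n = addFac s h (a + h) n * s (a + (n + 1) * h) *
      s (a + (n + 2) * h) / (s (a + h) * s (a + 2 * h)) := by
    rw [eq_div_iff (mul_ne_zero n1 n2),
      addFac_mul_right s n (y := a + 2 * h) (by ring) (by ring), mul_assoc (s (a + h)),
      addFac_mul_right s n (y := a + 2 * h + h) (by ring) (by ring)]
    ring
  have e2 : addFac s h (a + 2 * h - b) n =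
      addFac s h (a + h - b) n * s (a + (n + 1) * h - b) / s (a + h - b) := by
    rw [eq_div_iff n5]
    exact (mul_comm _ _).trans (addFac_mul_right s n (by ring) (by ring)).symm
  have e3 : addFac s h (a + 2 * h - c) n =
      addFac s h (a + h - c) n * s (a + (n + 1) * h - c) / s (a + h - c) := by
    rw [eq_div_iff n6]
    exact (mul_comm _ _).trans (addFac_mul_right s n (by ring) (by ring)).symm
  have e4 : addFac s h (a + 2 * h - d) n =
      addFac s h (a + h - d) n * s (a + (n + 1) * h - d) / s (a + h - d) := by
    rw [eq_div_iff n7]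
    exact (mul_comm _ _).trans (addFac_mul_right s n (by ring) (by ring)).symm
  have e5 : addFac s h (a - b - c - d) n =
      s (a - b - c - d) * addFac s h (a + h - b - c - d) n / s (a + n * h - b - c - d) := by
    rw [eq_div_iff n12, addFac_mul_right s n (y := a + h - b - c - d) (by ring) (by ring)]
  rw [e1, e2, e3, e4, e5,
    addFac_succ_right s n (x := a + h) (y := a + (n + 1) * h) (by ring),
    addFac_succ_right s n (x := a + h - b - c) (y := a + (n + 1) * h - b - c) (by ring),
    addFac_succ_right s n (x := a + h - b - d) (y := a + (n + 1) * h - b - d) (by ring),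
    addFac_succ_right s n (x := a + h - c - d) (y := a + (n + 1) * h - c - d) (by ring),
    addFac_succ_right s n (x := a + h - b) (y := a + (n + 1) * h - b) (by ring),
    addFac_succ_right s n (x := a + h - c) (y := a + (n + 1) * h - c) (by ring),
    addFac_succ_right s n (x := a + h - d) (y := a + (n + 1) * h - d) (by ring),
    addFac_succ_right s n (x := a + h - b - c - d) (y := a + (n + 1) * h - b - c - d) (by ring)]
  set V := addFac s h (a + h) n * addFac s h (a + h - b - c) n * addFac s h (a + h - b - d) n *
      addFac s h (a + h - c - d) n /
    (addFac s h (a + h - b) n * addFac s h (a + h - c) n * addFac s h (a + h - d) n *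
      addFac s h (a + h - b - c - d) n) with hV
  have q2 : V * (s (a + (n + 1) * h) * s (a + (n + 1) * h - b - c) *
        (s (a + (n + 1) * h - b - d) * s (a + (n + 1) * h - c - d)) /
      (s (a + (n + 1) * h - b) * s (a + (n + 1) * h - c) *
        (s (a + (n + 1) * h - d) * s (a + (n + 1) * h - b - c - d)))) = V +
      V * (s (2 * a + (n + 2) * h - b - c - d + n * h) * s d * (s c * s b) /
      (s (a + (n + 1) * h - b) * s (a + (n + 1) * h - c) *
        (s (a + (n + 1) * h - d) * s (a + (n + 1) * h - b - c - d)))) := by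
    rw [← q1, sub_div, div_self (by repeat' first | assumption | apply mul_ne_zero)]
    ring
  refine Eq.trans ?_ (q2.trans (congrArg (V + ·) ?_))
  all_goals
    simp only [hV, mul_div_assoc', div_mul_eq_mul_div, div_div, div_div_eq_mul_div]
    rw [div_eq_div_iff (by repeat' first | assumption | apply neg_ne_zero.2 | apply mul_ne_zero)
      (by repeat' first | assumption | apply neg_ne_zero.2 | apply mul_ne_zero)]
    ring

/-- The Frenkel–Turaev summation for generic parameters. -/
theorem sum_ftTerm (hs : IsOddTheta s) (h0 : ∀ m : ℤ, m ≠ 0 → s (m * h) ≠ 0) (n : ℕ) :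
    ∀ {a b c d e : ℂ}, Generic s h a → Generic s h (a - b) → Generic s h (a - c) →
      Generic s h (a - d) → Generic s h (a - e) → b + c + d + e = 2 * a + (n + 1) * h →
      ∑ k ∈ Finset.range (n + 1), ftTerm s h n a b c d e k = ftValue s h n a b c d := by
  induction n with
  | zero =>
    intro a b c d e ha _ _ _ _ _
    simp [ftTerm, ftValue, ha.ne (y := a) 0 (by simp)]
  | succ n ih =>
    intro a b c d e ha hb hc hd he hbal
    push_cast at hbal
    have hz : ∀ b' c' d' e' : ℂ, ftTerm s h n a b' c' d' e' (n + 1) = 0 := by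
      intro b' c' d' e'
      have : addFac s h (-n * h) (n + 1) = 0 := by
        rw [addFac_succ_right s n (y := 0) (by ring), hs.zero, mul_zero]
      rw [ftTerm, this, mul_zero, zero_div, mul_zero]
    have hzero : ftTerm s h (n + 1) a b c d e 0 = ftTerm s h n a b c d (e - h) 0 := by
      simp [ftTerm]
    -- Both contiguous sums, with e lowered by h and with (a, b, c, d) raised by (2h, h, h, h), are
    -- again balanced for length n.
    have i1 := ih ha hb hc hd (he.shift (y := a - (e - h)) 1 (by push_cast; ring))
      (by linear_combination hbal)
    have i2 := ih (a := a + 2 * h) (b := b + h) (c := c + h) (d := d + h) (e := e)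
      (ha.shift 2 (by push_cast; ring)) (hb.shift 1 (by push_cast; ring))
      (hc.shift 1 (by push_cast; ring)) (hd.shift 1 (by push_cast; ring))
      (he.shift 2 (by push_cast; ring)) (by linear_combination hbal)
    rw [Finset.sum_range_succ', hzero,
      Finset.sum_congr rfl fun i _ => ftTerm_succ hs h0 n ha hb hc hd he i,
      Finset.sum_add_distrib, ← Finset.mul_sum, i2, add_right_comm, ← Finset.sum_range_succ',
      Finset.sum_range_succ, i1, hz, add_zero,
      ftValue_succ hs n ha hb hc hd he (by linear_combination hbal)]

end

/-! ### Splitting and reversing shifted factorials -/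

theorem addFac_add (s : ℂ → ℂ) {h x y : ℂ} (k i : ℕ) (hy : y = x + k * h) :
    addFac s h x (k + i) = addFac s h x k * addFac s h y i := by
  rw [addFac, Finset.prod_range_add, hy, addFac, addFac]
  congr 1
  refine Finset.prod_congr rfl fun j _ => ?_
  congr 1
  push_cast
  ring

theorem addFac_two_mul (s : ℂ → ℂ) {h x y : ℂ} (k : ℕ) (hy : y = x + h) :
    addFac s h x (2 * k) = addFac s (2 * h) x k * addFac s (2 * h) y k := by
  subst hy
  induction k with
  | zero => simp
  | succ k ih =>
    rw [show 2 * (k + 1) = 2 * k + 1 + 1 by ring,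
      addFac_succ_right s (2 * k + 1) (y := x + h + k * (2 * h)) (by push_cast; ring),
      addFac_succ_right s (2 * k) (y := x + k * (2 * h)) (by push_cast; ring), ih,
      addFac_succ_right s k (x := x) rfl, addFac_succ_right s k (x := x + h) rfl]
    ring

theorem addFac_reflect {s : ℂ → ℂ} (hs : IsOddTheta s) {h x y : ℂ} (k : ℕ)
    (hy : y = -x - (k - 1) * h) : addFac s h y k = (-1) ^ k * addFac s h x k := by
  have hterm : ∀ i ∈ Finset.range k,
      s (y + ((k - 1 - i : ℕ) : ℂ) * h) = -1 * s (x + i * h) := fun i hi => by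
    have hik : i + 1 ≤ k := Finset.mem_range.1 hi
    rw [neg_one_mul, ← hs.neg, Nat.sub_sub, Nat.cast_sub (by omega), hy]
    congr 1
    push_cast
    ring
  rw [addFac, addFac, ← Finset.prod_range_reflect, Finset.prod_congr rfl hterm,
    Finset.prod_mul_distrib, Finset.prod_const, Finset.card_range]

theorem Generic.two_mul {s : ℂ → ℂ} {h x : ℂ} (hx : Generic s h x) {y : ℂ} (m : ℤ)
    (hy : y = x + m * h) : Generic s (2 * h) y := fun k =>
  hx.ne (m + 2 * k) (by rw [hy]; push_cast; ring)

theorem Generic.addFac_two_mul_ne {s : ℂ → ℂ} {h x : ℂ} (hx : Generic s h x) {y : ℂ} (m : ℤ)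
    (k : ℕ) (hy : y = x + m * h) : addFac s (2 * h) y k ≠ 0 :=
  (hx.two_mul m hy).addFac_ne 0 k (by simp)

theorem Generic.neg {s : ℂ → ℂ} (hs : IsOddTheta s) {h x : ℂ} (hx : Generic s h x) {y : ℂ} (m : ℤ)
    (hy : y = -x + m * h) : Generic s h y := fun k => by
  rw [show y + k * h = -(x + (-m - k : ℤ) * h) by rw [hy]; push_cast; ring, hs.neg]
  exact neg_ne_zero.2 (hx _)

/-! ### The telescoping bibasic sum -/

section

variable {s : ℂ → ℂ} {h : ℂ}

/-- The terms of the telescoping bibasic sum. -/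
noncomputable def bibasicTerm (s : ℂ → ℂ) (h a b c d A B : ℂ) (k : ℕ) : ℂ :=
  s (a + 3 * k * h) * s (d - h + k * h) *
    ((addFac s h b k * addFac s h c k * addFac s (2 * h) A k * addFac s (2 * h) B k) /
      (addFac s (2 * h) (a + 2 * h - b) k * addFac s (2 * h) (a + 2 * h - c) k *
        addFac s h (A + 2 * h - d) k * addFac s h (B + 2 * h - d) k))

/-- The antidifference of `bibasicTerm`. -/
noncomputable def bibasicSum (s : ℂ → ℂ) (h a b c d A B : ℂ) (k : ℕ) : ℂ :=
  s (a - b + 2 * k * h) * s (a - c + 2 * k * h) * s (A + h - d + k * h) * s (B + h - d + k * h) *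
    ((addFac s h b k * addFac s h c k * addFac s (2 * h) A k * addFac s (2 * h) B k) /
      (addFac s (2 * h) (a + 2 * h - b) k * addFac s (2 * h) (a + 2 * h - c) k *
        addFac s h (A + 2 * h - d) k * addFac s h (B + 2 * h - d) k))

/-- The new factors at k + 1 and the boundary factors at k are the two products on the left of one
three-term identity; its right side is the summand times a factor independent of k. -/
theorem bibasicSum_succ (hs : IsOddTheta s) {a b c d A B : ℂ} (hd : b + c + d = a + h)
    (hAB : A + B = a + d - h) (hb : Generic s h (a - b)) (hc : Generic s h (a - c))
    (hA : Generic s h (A - d)) (hB : Generic s h (B - d)) (k : ℕ) :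
    bibasicSum s h a b c d A B (k + 1) = bibasicSum s h a b c d A B k +
      s (a - b - B) * s (a - c - B) * bibasicTerm s h a b c d A B k := by
  have q1 : s (A + k * (2 * h)) * s (B + k * (2 * h)) * (s (c + k * h) * s (b + k * h)) -
      s (a - b + 2 * k * h) * s (a - c + 2 * k * h) *
        (s (A + h - d + k * h) * s (B + h - d + k * h)) =
      s (a + 3 * k * h) * s (d - h + k * h) * (s (a - b - B) * s (a - c - B)) := by
    obtain rfl : d = a + h - b - c := by linear_combination hd
    obtain rfl : A = 2 * a - b - c - B := by linear_combination hAB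
    exact hs.three_term_of ((2 * a - b - c) / 2 + 2 * k * h) ((2 * a - b - c - 2 * B) / 2)
      ((b + c) / 2 + k * h) ((c - b) / 2)
      (by ring) (by ring) (by ring) (by ring) (by ring) (by ring) (by ring) (by ring) (by ring)
      (by ring) (by ring) (by ring)
  have n1 := hb.ne (y := a + 2 * h - b + k * (2 * h)) (2 + 2 * k) (by push_cast; ring)
  have n2 := hc.ne (y := a + 2 * h - c + k * (2 * h)) (2 + 2 * k) (by push_cast; ring)
  have n3 := hA.ne (y := A + 2 * h - d + k * h) (2 + k) (by push_cast; ring)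
  have n4 := hB.ne (y := B + 2 * h - d + k * h) (2 + k) (by push_cast; ring)
  have m1 := hb.addFac_two_mul_ne (y := a + 2 * h - b) 2 k (by push_cast; ring)
  have m2 := hc.addFac_two_mul_ne (y := a + 2 * h - c) 2 k (by push_cast; ring)
  have m3 := hA.addFac_ne (y := A + 2 * h - d) 2 k (by push_cast; ring)
  have m4 := hB.addFac_ne (y := B + 2 * h - d) 2 k (by push_cast; ring)
  have e1 : bibasicSum s h a b c d A B (k + 1) =
      s (A + k * (2 * h)) * s (B + k * (2 * h)) * (s (c + k * h) * s (b + k * h)) *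
    ((addFac s h b k * addFac s h c k * addFac s (2 * h) A k * addFac s (2 * h) B k) /
      (addFac s (2 * h) (a + 2 * h - b) k * addFac s (2 * h) (a + 2 * h - c) k *
        addFac s h (A + 2 * h - d) k * addFac s h (B + 2 * h - d) k)) := by
    unfold bibasicSum
    rw [addFac_succ_right s k (x := b) rfl, addFac_succ_right s k (x := c) rfl,
      addFac_succ_right s k (x := A) rfl, addFac_succ_right s k (x := B) rfl,
      addFac_succ_right s k (x := a + 2 * h - b) rfl,
      addFac_succ_right s k (x := a + 2 * h - c) rfl,
      addFac_succ_right s k (x := A + 2 * h - d) rfl,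
      addFac_succ_right s k (x := B + 2 * h - d) rfl,
      show a - b + 2 * ((k + 1 : ℕ) : ℂ) * h = a + 2 * h - b + k * (2 * h) by push_cast; ring,
      show a - c + 2 * ((k + 1 : ℕ) : ℂ) * h = a + 2 * h - c + k * (2 * h) by push_cast; ring,
      show A + h - d + ((k + 1 : ℕ) : ℂ) * h = A + 2 * h - d + k * h by push_cast; ring,
      show B + h - d + ((k + 1 : ℕ) : ℂ) * h = B + 2 * h - d + k * h by push_cast; ring]
    simp only [mul_div_assoc']
    rw [div_eq_div_iff (by repeat' first | assumption | apply mul_ne_zero)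
      (by repeat' first | assumption | apply mul_ne_zero)]
    ring
  rw [e1]
  unfold bibasicSum bibasicTerm
  linear_combination ((addFac s h b k * addFac s h c k * addFac s (2 * h) A k *
    addFac s (2 * h) B k) /
      (addFac s (2 * h) (a + 2 * h - b) k * addFac s (2 * h) (a + 2 * h - c) k *
        addFac s h (A + 2 * h - d) k * addFac s h (B + 2 * h - d) k)) * q1

theorem sum_bibasicTerm (hs : IsOddTheta s) {a b c d : ℂ} (hd : b + c + d = a + h)
    (ha : Generic s h a) (hb : Generic s h (a - b)) (hc : Generic s h (a - c))
    (hgd : Generic s h d) (j : ℕ) :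
    ∑ k ∈ Finset.range (j + 1),
        bibasicTerm s h a b c d (a + d - h + j * (2 * h)) (-j * (2 * h)) k =
      s (a - b) * s (a - c) * s (a + 2 * j * h) * s (d - h + 2 * j * h) /
        (s (a - b + 2 * j * h) * s (a - c + 2 * j * h)) := by
  have hA : Generic s h (a + d - h + j * (2 * h) - d) := ha.shift (-1 + 2 * j) (by push_cast; ring)
  have hB : Generic s h (-j * (2 * h) - d) := hgd.neg hs (-2 * j) (by push_cast; ring)
  have hrec := bibasicSum_succ hs hd (A := a + d - h + j * (2 * h)) (B := -j * (2 * h)) (by ring)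
    hb hc hA hB
  have htel : ∀ m : ℕ, s (a - b - -j * (2 * h)) * s (a - c - -j * (2 * h)) *
      ∑ k ∈ Finset.range m, bibasicTerm s h a b c d (a + d - h + j * (2 * h)) (-j * (2 * h)) k =
      bibasicSum s h a b c d (a + d - h + j * (2 * h)) (-j * (2 * h)) m -
        bibasicSum s h a b c d (a + d - h + j * (2 * h)) (-j * (2 * h)) 0 := fun m => by
    induction m with
    | zero => simp
    | succ m ih =>
      rw [Finset.sum_range_succ, mul_add, ih, hrec m]
      ring
  -- The choice B = -2jh makes the sum terminate: the factorial of length j + 1 contains s(0).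
  have hlast : bibasicSum s h a b c d (a + d - h + j * (2 * h)) (-j * (2 * h)) (j + 1) = 0 := by
    have : addFac s (2 * h) (-j * (2 * h)) (j + 1) = 0 := by
      rw [addFac_succ_right s j (y := 0) (by ring), hs.zero, mul_zero]
    rw [bibasicSum, this, mul_zero, zero_div, mul_zero]
  have hfirst : bibasicSum s h a b c d (a + d - h + j * (2 * h)) (-j * (2 * h)) 0 =
      -(s (a - b) * s (a - c) * s (a + 2 * j * h) * s (d - h + 2 * j * h)) := by
    rw [bibasicSum, show -(j : ℂ) * (2 * h) + h - d + ((0 : ℕ) : ℂ) * h = -(d - h + 2 * j * h) by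
      push_cast; ring, hs.neg]
    simp only [addFac_zero, Nat.cast_zero, mul_zero, zero_mul, add_zero, mul_one, div_one]
    rw [show a + d - h + j * (2 * h) + h - d = a + 2 * j * h by ring]
    ring
  have h1 := htel (j + 1)
  rw [hlast, hfirst, show a - b - -(j : ℂ) * (2 * h) = a - b + 2 * j * h by ring,
    show a - c - -(j : ℂ) * (2 * h) = a - c + 2 * j * h by ring] at h1
  rw [eq_div_iff (mul_ne_zero (hb.ne (2 * j) (by push_cast; ring))
    (hc.ne (2 * j) (by push_cast; ring)))]
  linear_combination h1

end

/-! ### The cubic transformation with g = a/b -/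

section

variable {s : ℂ → ℂ} {h : ℂ}

/-- The factor of the cubic sum that depends on `e`, `f` and `n`. -/
noncomputable def cubicFactor (s : ℂ → ℂ) (h : ℂ) (n : ℕ) (a e f : ℂ) (k : ℕ) : ℂ :=
  addFac s (2 * h) e k * addFac s (2 * h) f k * addFac s (2 * h) (-n * (2 * h)) k /
    (addFac s h (a + h - e) k * addFac s h (a + h - f) k * addFac s h (a + (2 * n + 1) * h) k)

/-- The factor of the cubic sum that does not depend on `e`, `f` and `n`. -/
noncomputable def cubicWeight (s : ℂ → ℂ) (h a b c d : ℂ) (k : ℕ) : ℂ :=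
  s (a + 3 * k * h) / s a * (addFac s h b k * addFac s h c k * addFac s h d k /
    (addFac s (2 * h) (a + 2 * h - b) k * addFac s (2 * h) (a + 2 * h - c) k *
      addFac s (2 * h) (a + 2 * h - d) k))

/-- The genericity conditions used for the cubic transformation. -/
structure CubicGeneric (s : ℂ → ℂ) (h a b c d e : ℂ) : Prop where
  ne : ∀ m : ℤ, m ≠ 0 → s (m * h) ≠ 0
  gen_a : Generic s h a
  gen_d : Generic s h d
  gen_ab : Generic s h (a - b)
  gen_ac : Generic s h (a - c)
  gen_ad : Generic s h (a - d)
  gen_ae : Generic s h (a - e)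
  gen_apd : Generic s h (a + d)
  gen_apde : Generic s h (a + d - e)
  gen_ade : Generic s h (a - d - e)

theorem CubicGeneric.ne_two_mul {a b c d e : ℂ} (hg : CubicGeneric s h a b c d e) (m : ℤ)
    (hm : m ≠ 0) : s (m * (2 * h)) ≠ 0 := by
  have := hg.ne (m * 2) (by omega)
  push_cast at this
  rwa [mul_assoc] at this

theorem CubicGeneric.fac_ne {a b c d e : ℂ} (hg : CubicGeneric s h a b c d e) (k : ℕ) :
    addFac s (2 * h) (2 * h) k ≠ 0 := addFac_mul_self_ne hg.ne_two_mul k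

/-- The quotient of `cubicFactor` by the matching Frenkel–Turaev sum. -/
noncomputable def cubicQuot (s : ℂ → ℂ) (h : ℂ) (k N : ℕ) (a d e f : ℂ) : ℂ :=
  addFac s (2 * h) (2 * h) (k + N) * addFac s h (a + h) (2 * (k + N)) *
      addFac s (2 * h) (a + d + h) (2 * k) * addFac s (2 * h) (a + 2 * h - d) k *
      addFac s (2 * h) (a + d + h - e) (k + N) * addFac s (2 * h) (a + 2 * h - d - e) N *
      addFac s (2 * h) e k * addFac s (2 * h) f k /
    (addFac s (2 * h) (2 * h) N * addFac s h (a + h - e) (2 * (k + N)) *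
      addFac s h (a + h) (3 * k) * addFac s (2 * h) (a + d + h) (2 * k + N) *
      addFac s (2 * h) (a + 2 * h - d) (k + N) * addFac s (2 * h) (a + d + h - e) k)

/-- Reflection turns the factorials of a + h - f and -2nh into pieces of longer ones. Middle pieces
of length 2N in base h split by parity into two factorials of length N in base 2h, as the
Frenkel–Turaev value requires. -/
theorem cubicFactor_eq (hs : IsOddTheta s) {a b c d e f : ℂ} (hg : CubicGeneric s h a b c d e)
    (k N : ℕ) (hf : e + f = 2 * a + (2 * (k + N) + 1) * h) :
    cubicFactor s h (k + N) a e f k = cubicQuot s h k N a d e f *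
      ftValue s (2 * h) N (a + d - h + 4 * k * h) (e + 2 * k * h) (d + k * h) (d + k * h - h) := by
  obtain rfl : f = 2 * a + (2 * (k + N) + 1) * h - e := by linear_combination hf
  unfold cubicFactor cubicQuot ftValue
  have e1 : addFac s (2 * h) (-((k + N : ℕ) : ℂ) * (2 * h)) k =
      (-1) ^ k * addFac s (2 * h) (2 * h + N * (2 * h)) k :=
    addFac_reflect hs k (by push_cast; ring)
  have e2 : addFac s (2 * h) (2 * h) (k + N) =
      addFac s (2 * h) (2 * h) N * addFac s (2 * h) (2 * h + N * (2 * h)) k := by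
    rw [add_comm, addFac_add s N k rfl]
  have e3 : addFac s h (a + h - (2 * a + (2 * (k + N) + 1) * h - e)) k =
      (-1) ^ k * addFac s h (a + h - e + (k + 2 * N) * h) k :=
    addFac_reflect hs k (by ring)
  have e4 : addFac s h (a + h - e) (2 * (k + N)) = addFac s h (a + h - e) k *
      (addFac s (2 * h) (a + h - e + k * h) N * addFac s (2 * h) (a + 2 * h - e + k * h) N) *
      addFac s h (a + h - e + (k + 2 * N) * h) k := by
    rw [show 2 * (k + N) = k + 2 * N + k by ring,
      addFac_add s (k + 2 * N) k (y := a + h - e + (k + 2 * N) * h) (by push_cast; ring),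
      addFac_add s k (2 * N) (y := a + h - e + k * h) rfl,
      addFac_two_mul s N (y := a + 2 * h - e + k * h) (by ring)]
  have e5 : addFac s h (a + (2 * ((k + N : ℕ) : ℂ) + 1) * h) k = addFac s h (a + h) (3 * k) *
      (addFac s (2 * h) (a + h + 3 * k * h) N * addFac s (2 * h) (a + 2 * h + 3 * k * h) N) /
      addFac s h (a + h) (2 * (k + N)) := by
    rw [eq_div_iff (hg.gen_a.addFac_ne 1 _ (by push_cast; ring)), mul_comm,
      ← addFac_add s (2 * (k + N)) k (by push_cast; ring),
      ← addFac_two_mul s N (by ring), ← addFac_add s (3 * k) (2 * N) (by push_cast; ring)]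
    congr 1
    ring
  have e6 := addFac_add s (h := 2 * h) (x := a + d + h) (2 * k) N (y := a + d + h + 4 * k * h)
    (by push_cast; ring)
  have e7 := addFac_add s (h := 2 * h) (x := a + 2 * h - d) k N (y := a + 2 * h - d + 2 * k * h)
    (by ring)
  have e8 := addFac_add s (h := 2 * h) (x := a + d + h - e) k N (y := a + d + h - e + 2 * k * h)
    (by ring)
  rw [e1, e2, e3, e4, e5, e6, e7, e8,
    show a + d - h + 4 * k * h + 2 * h = a + d + h + 4 * k * h by ring,
    show a + d + h + 4 * k * h - (e + 2 * k * h) = a + d + h - e + 2 * k * h by ring,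
    show a + d + h + 4 * k * h - (d + k * h) = a + h + 3 * k * h by ring,
    show a + d + h + 4 * k * h - (d + k * h - h) = a + 2 * h + 3 * k * h by ring,
    show a + d + h - e + 2 * k * h - (d + k * h) = a + h - e + k * h by ring,
    show a + d + h - e + 2 * k * h - (d + k * h - h) = a + 2 * h - e + k * h by ring,
    show a + h + 3 * k * h - (d + k * h - h) = a + 2 * h - d + 2 * k * h by ring,
    show a + h - e + k * h - (d + k * h - h) = a + 2 * h - d - e by ring]
  have m1 := hg.fac_ne N
  have m2 : addFac s (2 * h) (2 * h + N * (2 * h)) k ≠ 0 := by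
    have := hg.fac_ne (k + N)
    rw [e2] at this
    exact right_ne_zero_of_mul this
  have m3 := hg.gen_ae.addFac_ne (y := a + h - e + (k + 2 * N) * h) (1 + k + 2 * N) k
    (by push_cast; ring)
  have m4 := hg.gen_ae.addFac_ne (y := a + h - e) 1 k (by push_cast; ring)
  have m5 := hg.gen_ae.addFac_two_mul_ne (y := a + h - e + k * h) (1 + k) N (by push_cast; ring)
  have m6 := hg.gen_ae.addFac_two_mul_ne (y := a + 2 * h - e + k * h) (2 + k) N (by push_cast; ring)
  have m7 := hg.gen_a.addFac_ne (y := a + h) 1 (3 * k) (by push_cast; ring)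
  have m8 := hg.gen_a.addFac_ne (y := a + h) 1 (2 * (k + N)) (by push_cast; ring)
  have m9 := hg.gen_a.addFac_two_mul_ne (y := a + h + 3 * k * h) (1 + 3 * k) N (by push_cast; ring)
  have m10 := hg.gen_a.addFac_two_mul_ne (y := a + 2 * h + 3 * k * h) (2 + 3 * k) N (by push_cast; ring)
  have m11 := hg.gen_apd.addFac_two_mul_ne (y := a + d + h) 1 (2 * k) (by push_cast; ring)
  have m12 := hg.gen_apd.addFac_two_mul_ne (y := a + d + h + 4 * k * h) (1 + 4 * k) N
    (by push_cast; ring)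
  have m13 := hg.gen_ad.addFac_two_mul_ne (y := a + 2 * h - d) 2 k (by push_cast; ring)
  have m14 := hg.gen_ad.addFac_two_mul_ne (y := a + 2 * h - d + 2 * k * h) (2 + 2 * k) N
    (by push_cast; ring)
  have m15 := hg.gen_apde.addFac_two_mul_ne (y := a + d + h - e) 1 k (by push_cast; ring)
  have m16 := hg.gen_apde.addFac_two_mul_ne (y := a + d + h - e + 2 * k * h) (1 + 2 * k) N
    (by push_cast; ring)
  have m17 := hg.gen_ade.addFac_two_mul_ne (y := a + 2 * h - d - e) 2 N (by push_cast; ring)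
  have m18 : ((-1) ^ k : ℂ) ≠ 0 := pow_ne_zero _ (by norm_num)
  simp only [mul_div_assoc', div_mul_eq_mul_div, div_div, div_div_eq_mul_div]
  rw [div_eq_div_iff (by repeat' first | assumption | apply mul_ne_zero)
    (by repeat' first | assumption | apply mul_ne_zero)]
  ring
end

section

variable {s : ℂ → ℂ} {h : ℂ}

/-- The part of the transformed cubic sum that depends only on `n`. -/
noncomputable def cubicConst (s : ℂ → ℂ) (h : ℂ) (n : ℕ) (a d e : ℂ) : ℂ :=
  addFac s (2 * h) (2 * h) n * addFac s h (a + h) (2 * n) * addFac s (2 * h) (a + d + h - e) n *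
      addFac s (2 * h) (a + 2 * h - d - e) n /
    (addFac s h (a + h - e) (2 * n) * addFac s (2 * h) (a + 2 * h - d) n)

/-- The part of the transformed cubic sum that depends only on `j`, with `n = j + M`. -/
noncomputable def cubicInner (s : ℂ → ℂ) (h : ℂ) (j M : ℕ) (a d e f : ℂ) : ℂ :=
  s (a + d - h + 4 * j * h) * addFac s (2 * h) e j * addFac s (2 * h) f j * (-1) ^ j *
      addFac s (2 * h) (a + d - h) j * addFac s h (d - h) (2 * j) /
    (s (a + d - h) * s a * s (d - h) * addFac s (2 * h) (2 * h) M *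
      addFac s (2 * h) (a + d + h - e) j * addFac s (2 * h) (a + d + h - f) j *
      addFac s (2 * h) (a + d + h) (2 * j + M) * addFac s (2 * h) (2 * h) j *
      addFac s h (a + h) (2 * j))

/-- Separation of variables after the interchange, with n = k + i + M and j = k + i: apart from
factors depending on n and on j, the dependence on k is a bibasic summand, so the sum over k can be
evaluated. -/
theorem cubicQuot_mul_ftTerm (hs : IsOddTheta s) {a b c d e f : ℂ}
    (hg : CubicGeneric s h a b c d e) (k i M : ℕ)
    (hf : e + f = 2 * a + (2 * (k + i + M) + 1) * h) :
    cubicWeight s h a b c d k * (cubicQuot s h k (i + M) a d e f *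
      ftTerm s (2 * h) (i + M) (a + d - h + 4 * k * h) (e + 2 * k * h) (d + k * h) (d + k * h - h)
        (f + 2 * k * h) i) =
    cubicConst s h (k + i + M) a d e * (cubicInner s h (k + i) M a d e f *
      bibasicTerm s h a b c d (a + d - h + ((k + i : ℕ) : ℂ) * (2 * h))
        (-((k + i : ℕ) : ℂ) * (2 * h)) k) := by
  obtain rfl : f = 2 * a + (2 * (k + i + M) + 1) * h - e := by linear_combination hf
  -- By balancing, a + d - f is the negative of a - d - e up to a multiple of h, so this needs no
  -- separate genericity condition.
  have hadf : Generic s h (a + d - (2 * a + (2 * (k + i + M) + 1) * h - e)) :=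
    hg.gen_ade.neg hs (-(2 * (k + i + M) + 1)) (by push_cast; ring)
  set f := 2 * a + (2 * (k + i + M) + 1) * h - e with hfdef
  unfold cubicWeight cubicQuot ftTerm cubicConst cubicInner bibasicTerm
  rw [show k + (i + M) = k + i + M by ring, show 2 * k + (i + M) = 2 * k + i + M by ring,
    show 2 * (k + i) + M = (2 * k + i + M) + i by ring,
    show a + d - h + 4 * k * h + 2 * h - (e + 2 * k * h) = a + d + h - e + 2 * k * h by ring,
    show a + d - h + 4 * k * h + 2 * h - (f + 2 * k * h) = a + d + h - f + 2 * k * h by ring,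
    show a + d - h + 4 * k * h + 2 * h - (d + k * h) = a + h + 3 * k * h by ring,
    show a + d - h + 4 * k * h + 2 * h - (d + k * h - h) = a + 2 * h + 3 * k * h by ring,
    show a + d - h + 4 * k * h + 2 * i * (2 * h) = a + d - h + 4 * ((k + i : ℕ) : ℂ) * h by
      push_cast; ring]
  have e1 : addFac s (2 * h) (-((i + M : ℕ) : ℂ) * (2 * h)) i =
      (-1) ^ i * addFac s (2 * h) (2 * h + M * (2 * h)) i :=
    addFac_reflect hs i (by push_cast; ring)
  have e2 : addFac s (2 * h) (2 * h) (i + M) =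
      addFac s (2 * h) (2 * h) M * addFac s (2 * h) (2 * h + M * (2 * h)) i := by
    rw [add_comm, addFac_add s M i rfl]
  have e3 : addFac s (2 * h) (a + 2 * h - d - e) (k + i + M) =
      addFac s (2 * h) (a + 2 * h - d - e) (i + M) *
        addFac s (2 * h) (a + 2 * h - d - e + (i + M) * (2 * h)) k := by
    rw [show k + i + M = i + M + k by ring]
    exact addFac_add s (i + M) k (by push_cast; ring)
  have e4 : addFac s (2 * h) (a + d + h - f) (k + i) =
      (-1) ^ k * addFac s (2 * h) (a + 2 * h - d - e + (i + M) * (2 * h)) k *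
        addFac s (2 * h) (a + d + h - f + 2 * k * h) i := by
    rw [addFac_add s k i (y := a + d + h - f + 2 * k * h) (by ring)]
    congr 1
    exact addFac_reflect hs k (by rw [hfdef]; ring)
  have e5 := addFac_add s (h := 2 * h) (x := e) k i (y := e + 2 * k * h) (by ring)
  have e6 := addFac_add s (h := 2 * h) (x := f) k i (y := f + 2 * k * h) (by ring)
  have e7 := addFac_add s (h := 2 * h) (x := a + d + h - e) k i (y := a + d + h - e + 2 * k * h)
    (by ring)
  have n1 : s (a + d - h) ≠ 0 := hg.gen_apd.ne (-1) (by push_cast; ring)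
  have n2 : s (a + d - h + 4 * k * h) ≠ 0 := hg.gen_apd.ne (-1 + 4 * k) (by push_cast; ring)
  have n3 : s a ≠ 0 := hg.gen_a.ne 0 (by simp)
  have n4 : s (d - h) ≠ 0 := hg.gen_d.ne (-1) (by push_cast; ring)
  have m1 := hg.gen_apd.addFac_two_mul_ne (y := a + d - h) (-1) (k + i) (by push_cast; ring)
  have m2 := hg.gen_a.addFac_ne (y := a + h) 1 (2 * (k + i)) (by push_cast; ring)
  have e8 : addFac s (2 * h) (a + d - h + ((k + i : ℕ) : ℂ) * (2 * h)) k =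
      addFac s (2 * h) (a + d - h) (2 * k) * addFac s (2 * h) (a + d - h + 4 * k * h) i /
        addFac s (2 * h) (a + d - h) (k + i) := by
    rw [eq_div_iff m1, mul_comm, ← addFac_add s (k + i) k rfl,
      ← addFac_add s (2 * k) i (by push_cast; ring)]
    congr 1
    ring
  have e9 : addFac s (2 * h) (a + d + h) (2 * k) =
      addFac s (2 * h) (a + d - h) (2 * k) * s (a + d - h + 4 * k * h) / s (a + d - h) := by
    rw [eq_div_iff n1, mul_comm]
    exact (addFac_mul_right s (2 * k) (by ring) (by push_cast; ring)).symm
  have e10 : addFac s h (-((k + i : ℕ) : ℂ) * (2 * h) + 2 * h - d) k =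
      (-1) ^ k * addFac s h (d - h + (k + 2 * i) * h) k :=
    addFac_reflect hs k (by push_cast; ring)
  have e11 : addFac s h (d - h) (2 * (k + i)) = addFac s h (d - h) k *
      (addFac s (2 * h) (d + k * h - h) i * addFac s (2 * h) (d + k * h) i) *
        addFac s h (d - h + (k + 2 * i) * h) k := by
    rw [show 2 * (k + i) = k + 2 * i + k by ring,
      addFac_add s (k + 2 * i) k (y := d - h + (k + 2 * i) * h) (by push_cast; ring),
      addFac_add s k (2 * i) (y := d + k * h - h) (by ring),
      addFac_two_mul s i (y := d + k * h) (by ring)]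
  have e12 : addFac s h d k = addFac s h (d - h) k * s (d - h + k * h) / s (d - h) := by
    rw [eq_div_iff n4, mul_comm]
    exact (addFac_mul_right s k (by ring) rfl).symm
  have e13 : addFac s (2 * h) (-((k + i : ℕ) : ℂ) * (2 * h)) k =
      (-1) ^ k * addFac s (2 * h) (2 * h + i * (2 * h)) k :=
    addFac_reflect hs k (by push_cast; ring)
  have e14 : addFac s (2 * h) (2 * h) (k + i) =
      addFac s (2 * h) (2 * h) i * addFac s (2 * h) (2 * h + i * (2 * h)) k := by
    rw [add_comm, addFac_add s i k rfl]
  have e15 : addFac s h (a + d - h + ((k + i : ℕ) : ℂ) * (2 * h) + 2 * h - d) k =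
      addFac s h (a + h) (3 * k) *
      (addFac s (2 * h) (a + h + 3 * k * h) i * addFac s (2 * h) (a + 2 * h + 3 * k * h) i) /
      addFac s h (a + h) (2 * (k + i)) := by
    rw [eq_div_iff m2, mul_comm,
      ← addFac_add s (2 * (k + i)) k (by push_cast; ring),
      ← addFac_two_mul s i (by ring), ← addFac_add s (3 * k) (2 * i) (by push_cast; ring)]
    congr 1
    ring
  have e16 := addFac_add s (h := 2 * h) (x := a + d + h) (2 * k + i + M) i
    (y := a + d - h + 4 * k * h + ((i + M : ℕ) + 1) * (2 * h)) (by push_cast; ring)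
  have r1 := hg.fac_ne (k + i)
  have r2 := hg.fac_ne (i + M)
  rw [e14] at r1
  rw [e2] at r2
  have r3 := left_ne_zero_of_mul r1
  have r4 := right_ne_zero_of_mul r1
  have r5 := left_ne_zero_of_mul r2
  have r6 := right_ne_zero_of_mul r2
  clear r1 r2
  have p1 : ((-1) ^ k : ℂ) ≠ 0 := pow_ne_zero _ (by norm_num)
  have p3 : (-1 : ℂ) ^ (k + i) = (-1) ^ k * (-1) ^ i := pow_add _ _ _
  have := hg.gen_ab.addFac_two_mul_ne (y := a + 2 * h - b) (2) (k) (by push_cast; ring)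
  have := hg.gen_ac.addFac_two_mul_ne (y := a + 2 * h - c) (2) (k) (by push_cast; ring)
  have := hg.gen_ad.addFac_two_mul_ne (y := a + 2 * h - d) (2) (k) (by push_cast; ring)
  have := hg.gen_ae.addFac_ne (y := a + h - e) (1) (2 * (k + i + M)) (by push_cast; ring)
  have := hg.gen_a.addFac_ne (y := a + h) (1) (3 * k) (by push_cast; ring)
  have := hg.gen_apd.addFac_two_mul_ne (y := a + d + h) (1) (2 * k + i + M) (by push_cast; ring)
  have := hg.gen_ad.addFac_two_mul_ne (y := a + 2 * h - d) (2) (k + i + M) (by push_cast; ring)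
  have := hg.gen_apde.addFac_two_mul_ne (y := a + d + h - e) (1) (k) (by push_cast; ring)
  have := hg.gen_apde.addFac_two_mul_ne (y := a + d + h - e + 2 * k * h) (1 + 2 * k) (i) (by push_cast; ring)
  have := hg.gen_a.addFac_two_mul_ne (y := a + h + 3 * k * h) (1 + 3 * k) (i) (by push_cast; ring)
  have := hg.gen_a.addFac_two_mul_ne (y := a + 2 * h + 3 * k * h) (2 + 3 * k) (i) (by push_cast; ring)
  have := hadf.addFac_two_mul_ne (y := a + d + h - f + 2 * k * h) (1 + 2 * k) i
    (by push_cast; ring)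
  have := hg.gen_apd.addFac_two_mul_ne (y := a + d - h + 4 * k * h + ((i + M : ℕ) + 1) * (2 * h)) (1 + 4 * k + 2 * (i + M)) (i) (by push_cast; ring)
  have := hg.gen_ade.addFac_two_mul_ne (y := a + 2 * h - d - e + (i + M) * (2 * h)) (2 + 2 * (i + M)) (k) (by push_cast; ring)
  have := hg.gen_d.addFac_ne (y := d - h + (k + 2 * i) * h) (-1 + k + 2 * i) (k) (by push_cast; ring)
  rw [e1, e2, e3, e4, e5, e6, e7, e8, e9, e10, e11, e12, e13, e14, e15, e16, p3]
  simp only [mul_div_assoc', div_mul_eq_mul_div, div_div, div_div_eq_mul_div]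
  rw [div_eq_div_iff (by repeat' first | assumption | apply mul_ne_zero)
    (by repeat' first | assumption | apply mul_ne_zero)]
  ring

end

section

variable {s : ℂ → ℂ} {h : ℂ}

/-- The terms of the terminating very-well-poised series in additive notation. -/
noncomputable def omegaTerm (s : ℂ → ℂ) (h : ℂ) (n : ℕ) (a b c d e f g : ℂ) (k : ℕ) : ℂ :=
  s (a + 2 * k * h) / s a *
    ((addFac s h a k * addFac s h b k * addFac s h c k * addFac s h d k * addFac s h e k *
      addFac s h f k * addFac s h g k * addFac s h (-n * h) k) /
    (addFac s h h k * addFac s h (a + h - b) k * addFac s h (a + h - c) k *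
      addFac s h (a + h - d) k * addFac s h (a + h - e) k * addFac s h (a + h - f) k *
      addFac s h (a + h - g) k * addFac s h (a + (n + 1) * h) k))

/-- The prefactor in the cubic transformation. -/
noncomputable def cubicPre (s : ℂ → ℂ) (h : ℂ) (n : ℕ) (a b c d e g : ℂ) : ℂ :=
  addFac s (2 * h) (a + 2 * h) n * addFac s (2 * h) (2 * a + 2 * h - b - c - e) n *
      addFac s (2 * h) (2 * a + 2 * h - b - d - e - g) n *
      addFac s (2 * h) (a + g + 2 * h - c - d) n /
    (addFac s (2 * h) (2 * a + 2 * h - b - e - g) n * addFac s (2 * h) (a + g + 2 * h - c) n *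
      addFac s (2 * h) (a + 2 * h - d) n * addFac s (2 * h) (2 * a + 2 * h - b - c - d - e) n)

/-- Once the bibasic value is inserted, base-h factorials of even length split by parity: the one at
d - h yields the series parameters d and d + h, and the quotients at a - b and a - c become shifted
factorials. -/
theorem cubicPre_mul_omegaTerm (hs : IsOddTheta s) {a b c d e f : ℂ}
    (hg : CubicGeneric s h a b c d e) (j M : ℕ) (hd : b + c + d = a + h)
    (hf : e + f = 2 * a + (2 * (j + M) + 1) * h) :
    cubicConst s h (j + M) a d e * (cubicInner s h j M a d e f *
      (s (a - b) * s (a - c) * s (a + 2 * j * h) * s (d - h + 2 * j * h) /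
        (s (a - b + 2 * j * h) * s (a - c + 2 * j * h)))) =
    cubicPre s h (j + M) a b c d e (a - b) *
      omegaTerm s (2 * h) (j + M) (a + (a - b) - c) (a - c) (a - b + 2 * h - c) (b + e + (a - b) - a)
        d f (a - b) j := by
  have hadf : Generic s h (a + d - f) :=
    hg.gen_ade.neg hs (-(2 * (j + M) + 1)) (by push_cast; linear_combination -hf)
  unfold cubicConst cubicInner cubicPre omegaTerm
  rw [show 2 * a + 2 * h - b - c - e = a + d + h - e by linear_combination -hd,
    show 2 * a + 2 * h - b - d - e - (a - b) = a + 2 * h - d - e by ring,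
    show a + (a - b) + 2 * h - c - d = a + h by linear_combination -hd,
    show 2 * a + 2 * h - b - e - (a - b) = a + 2 * h - e by ring,
    show a + (a - b) + 2 * h - c = a + d + h by linear_combination -hd,
    show 2 * a + 2 * h - b - c - d - e = a + h - e by linear_combination -hd,
    show a + (a - b) - c = a + d - h by linear_combination -hd,
    show a - b + 2 * h - c = d + h by linear_combination -hd,
    show b + e + (a - b) - a = e by ring,
    show a + d - h + 2 * h - (a - c) = a + 2 * h - b by linear_combination hd,
    show a + d - h + 2 * h - (d + h) = a by ring,
    show a + d - h + 2 * h - e = a + d + h - e by ring,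
    show a + d - h + 2 * h - d = a + h by ring,
    show a + d - h + 2 * h - f = a + d + h - f by ring,
    show a + d - h + 2 * h - (a - b) = a + 2 * h - c by linear_combination hd,
    show a + d - h + 2 * j * (2 * h) = a + d - h + 4 * j * h by ring]
  have e1 : addFac s (2 * h) (-((j + M : ℕ) : ℂ) * (2 * h)) j =
      (-1) ^ j * addFac s (2 * h) (2 * h + M * (2 * h)) j :=
    addFac_reflect hs j (by push_cast; ring)
  have e2 : addFac s (2 * h) (2 * h) (j + M) =
      addFac s (2 * h) (2 * h) M * addFac s (2 * h) (2 * h + M * (2 * h)) j := by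
    rw [add_comm, addFac_add s M j rfl]
  have e3 : addFac s h (a + h) (2 * (j + M)) =
      addFac s (2 * h) (a + h) (j + M) * addFac s (2 * h) (a + 2 * h) (j + M) :=
    addFac_two_mul s _ (by ring)
  have e4 : addFac s h (a + h - e) (2 * (j + M)) =
      addFac s (2 * h) (a + h - e) (j + M) * addFac s (2 * h) (a + 2 * h - e) (j + M) :=
    addFac_two_mul s _ (by ring)
  have e5 : addFac s (2 * h) (a + d + h) (2 * j + M) = addFac s (2 * h) (a + d + h) (j + M) *
      addFac s (2 * h) (a + d - h + (((j + M : ℕ) : ℂ) + 1) * (2 * h)) j := by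
    rw [show 2 * j + M = j + M + j by ring]
    exact addFac_add s (j + M) j (by push_cast; ring)
  have n1 : s (d - h + 2 * j * h) ≠ 0 := hg.gen_d.ne (-1 + 2 * j) (by push_cast; ring)
  have n2 : s a ≠ 0 := hg.gen_a.ne 0 (by simp)
  have n3 : s (a - b + 2 * j * h) ≠ 0 := hg.gen_ab.ne (2 * j) (by push_cast; ring)
  have n4 : s (a - c + 2 * j * h) ≠ 0 := hg.gen_ac.ne (2 * j) (by push_cast; ring)
  have n5 : s (a + 2 * j * h) ≠ 0 := hg.gen_a.ne (2 * j) (by push_cast; ring)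
  have n6 : s (a + d - h) ≠ 0 := hg.gen_apd.ne (-1) (by push_cast; ring)
  have n7 : s (d - h) ≠ 0 := hg.gen_d.ne (-1) (by push_cast; ring)
  have e6 : addFac s h (d - h) (2 * j) =
      s (d - h) * (addFac s (2 * h) d j * addFac s (2 * h) (d + h) j) / s (d - h + 2 * j * h) := by
    rw [eq_div_iff n1, ← addFac_two_mul s j rfl]
    exact addFac_mul_right s (2 * j) (by ring) (by push_cast; ring)
  have e7 : addFac s h (a + h) (2 * j) =
      addFac s (2 * h) a j * addFac s (2 * h) (a + h) j * s (a + 2 * j * h) / s a := by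
    rw [eq_div_iff n2, ← addFac_two_mul s j rfl, mul_comm]
    exact (addFac_mul_right s (2 * j) rfl (by push_cast; ring)).symm
  have e8 : addFac s (2 * h) (a - b) j =
      s (a - b) * addFac s (2 * h) (a + 2 * h - b) j / s (a - b + 2 * j * h) := by
    rw [eq_div_iff n3]
    exact addFac_mul_right s j (by ring) (by ring)
  have e9 : addFac s (2 * h) (a - c) j =
      s (a - c) * addFac s (2 * h) (a + 2 * h - c) j / s (a - c + 2 * j * h) := by
    rw [eq_div_iff n4]
    exact addFac_mul_right s j (by ring) (by ring)
  have r1 := hg.fac_ne j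
  have r2 := hg.fac_ne M
  have p1 : ((-1) ^ j : ℂ) ≠ 0 := pow_ne_zero _ (by norm_num)
  have := hg.gen_ab.addFac_two_mul_ne (y := a + 2 * h - b) (2) (j) (by push_cast; ring)
  have := hg.gen_ac.addFac_two_mul_ne (y := a + 2 * h - c) (2) (j) (by push_cast; ring)
  have := hg.gen_ad.addFac_two_mul_ne (y := a + 2 * h - d) (2) (j + M) (by push_cast; ring)
  have := hg.gen_ae.addFac_two_mul_ne (y := a + h - e) (1) (j + M) (by push_cast; ring)
  have := hg.gen_ae.addFac_two_mul_ne (y := a + 2 * h - e) (2) (j + M) (by push_cast; ring)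
  have := hg.gen_a.addFac_two_mul_ne (y := a) (0) (j) (by push_cast; ring)
  have := hg.gen_a.addFac_two_mul_ne (y := a + h) (1) (j) (by push_cast; ring)
  have := hg.gen_apd.addFac_two_mul_ne (y := a + d + h) (1) (j + M) (by push_cast; ring)
  have := hg.gen_apde.addFac_two_mul_ne (y := a + d + h - e) (1) (j) (by push_cast; ring)
  have := hadf.addFac_two_mul_ne (y := a + d + h - f) 1 j (by push_cast; ring)
  have := hg.gen_apd.addFac_two_mul_ne (y := a + d - h + (((j + M : ℕ) : ℂ) + 1) * (2 * h)) (1 + 2 * (j + M)) (j) (by push_cast; ring)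
  rw [e1, e2, e3, e4, e5, e6, e7, e8, e9]
  simp only [mul_div_assoc', div_mul_eq_mul_div, div_div, div_div_eq_mul_div]
  rw [div_eq_div_iff (by repeat' first | assumption | apply mul_ne_zero)
    (by repeat' first | assumption | apply mul_ne_zero)]
  ring

/-- The cubic transformation with `g = a / b`, for generic parameters. -/
theorem sum_cubic_eq_of_ab (hs : IsOddTheta s) {a b c d e f : ℂ}
    (hg : CubicGeneric s h a b c d e) (n : ℕ) (hd : b + c + d = a + h)
    (hf : e + f = 2 * a + (2 * n + 1) * h) :
    ∑ k ∈ Finset.range (n + 1), cubicWeight s h a b c d k * cubicFactor s h n a e f k =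
      cubicPre s h n a b c d e (a - b) * ∑ j ∈ Finset.range (n + 1),
        omegaTerm s (2 * h) n (a + (a - b) - c) (a - c) (a - b + 2 * h - c) (b + e + (a - b) - a)
          d f (a - b) j := by
  have hadf : Generic s h (a + d - f) :=
    hg.gen_ade.neg hs (-(2 * n + 1)) (by push_cast; linear_combination -hf)
  have hexp : ∀ k ∈ Finset.range (n + 1),
      cubicWeight s h a b c d k * cubicFactor s h n a e f k =
      ∑ i ∈ Finset.range (n + 1 - k), cubicWeight s h a b c d k *
        (cubicQuot s h k (n - k) a d e f * ftTerm s (2 * h) (n - k) (a + d - h + 4 * k * h)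
          (e + 2 * k * h) (d + k * h) (d + k * h - h) (f + 2 * k * h) i) := by
    intro k hk
    obtain ⟨N, rfl⟩ : ∃ N, n = k + N := ⟨n - k, by have := Finset.mem_range.1 hk; omega⟩
    push_cast at hf
    rw [← Finset.mul_sum, ← Finset.mul_sum, cubicFactor_eq hs hg k N hf,
      show k + N + 1 - k = N + 1 by omega, show k + N - k = N by omega,
      sum_ftTerm hs hg.ne_two_mul N
        (hg.gen_apd.two_mul (-1 + 4 * k) (by push_cast; ring))
        (hg.gen_apde.two_mul (-1 + 2 * k) (by push_cast; ring))
        (hg.gen_a.two_mul (-1 + 3 * k) (by push_cast; ring))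
        (hg.gen_a.two_mul (3 * k) (by push_cast; ring))
        (hadf.two_mul (-1 + 2 * k) (by push_cast; ring))
        (by linear_combination hf)]
  -- The double sum over k + i ≤ n is reorganised along the diagonals j = k + i.
  rw [Finset.sum_congr rfl hexp, ← Finset.sum_range_diag_flip (n + 1) fun k i =>
    cubicWeight s h a b c d k *
        (cubicQuot s h k (n - k) a d e f * ftTerm s (2 * h) (n - k) (a + d - h + 4 * k * h)
          (e + 2 * k * h) (d + k * h) (d + k * h - h) (f + 2 * k * h) i), Finset.mul_sum]
  refine Finset.sum_congr rfl fun j hj => ?_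
  obtain ⟨M, rfl⟩ : ∃ M, n = j + M := ⟨n - j, by have := Finset.mem_range.1 hj; omega⟩
  have hf' : e + f = 2 * a + (2 * (j + M) + 1) * h := by
    push_cast at hf
    exact hf
  rw [← cubicPre_mul_omegaTerm hs hg j M hd hf',
    ← sum_bibasicTerm hs hd hg.gen_a hg.gen_ab hg.gen_ac hg.gen_d j, Finset.mul_sum, Finset.mul_sum]
  refine Finset.sum_congr rfl fun k hk => ?_
  obtain ⟨i, rfl⟩ : ∃ i, j = k + i := ⟨j - k, by have := Finset.mem_range.1 hk; omega⟩
  rw [show k + i + M - k = i + M by omega, show k + i - k = i by omega,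
    cubicQuot_mul_ftTerm hs hg k i M (by push_cast at hf'; exact hf')]

end

/-! ### The elliptic Bailey transformation -/

section

variable {s : ℂ → ℂ} {h : ℂ}

/-- The genericity conditions used for the transformation of the very-well-poised series. -/
structure OmegaGeneric (s : ℂ → ℂ) (h a l b c d e f g : ℂ) : Prop where
  ne : ∀ m : ℤ, m ≠ 0 → s (m * h) ≠ 0
  gen_a : Generic s h a
  gen_l : Generic s h l
  gen_al : Generic s h (a - l)
  gen_ab : Generic s h (a - b)
  gen_ac : Generic s h (a - c)
  gen_ad : Generic s h (a - d)
  gen_ae : Generic s h (a - e)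
  gen_af : Generic s h (a - f)
  gen_ag : Generic s h (a - g)
  gen_le : Generic s h (l - e)
  gen_lf : Generic s h (l - f)
  gen_lg : Generic s h (l - g)

/-- The prefactor in the transformation of the very-well-poised series. -/
noncomputable def omegaPre (s : ℂ → ℂ) (h : ℂ) (n : ℕ) (a l e f : ℂ) : ℂ :=
  addFac s h (a + h) n * addFac s h (a + h - e - f) n * addFac s h (l + h - e) n *
      addFac s h (l + h - f) n /
    (addFac s h (a + h - e) n * addFac s h (a + h - f) n * addFac s h (l + h - e - f) n *
      addFac s h (l + h) n)

/-- The factor of `omegaTerm` that remains after expanding three of its parameter pairs. -/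
noncomputable def omegaOuter (s : ℂ → ℂ) (h : ℂ) (n : ℕ) (a l e f g : ℂ) (k : ℕ) : ℂ :=
  s (a + 2 * k * h) / s a *
    ((addFac s h a k * addFac s h e k * addFac s h f k * addFac s h g k * addFac s h (-n * h) k *
      addFac s h (a - l) k) /
    (addFac s h h k * addFac s h (a + h - e) k * addFac s h (a + h - f) k *
      addFac s h (a + h - g) k * addFac s h (a + (n + 1) * h) k * addFac s h (l + h) k))

/-- The factor in front of the inner sum after interchanging the order of summation. -/
noncomputable def omegaInner (s : ℂ → ℂ) (h : ℂ) (j N : ℕ) (a l b c d e f g : ℂ) : ℂ :=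
  s (l + 2 * j * h) / s l * (addFac s h l j * addFac s h (l + b - a) j * addFac s h (l + c - a) j *
      addFac s h (l + d - a) j /
    (addFac s h h j * addFac s h (a + h - b) j * addFac s h (a + h - c) j *
      addFac s h (a + h - d) j)) *
    (s (a + 2 * j * h) / s a * (addFac s h a (2 * j) * addFac s h e j * addFac s h f j *
      addFac s h g j * (-1) ^ j * addFac s h h (j + N) * addFac s h (a + h) (j + N) /
    (addFac s h (a + h - e) j * addFac s h (a + h - f) j * addFac s h (a + h - g) j *
      addFac s h h N * addFac s h (a + h) (2 * j + N) * addFac s h (l + h) (2 * j))))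

/-- The condition on l makes the factorials of b, c, d and of their partners part of a
Frenkel–Turaev value of length k, ready to be expanded. -/
theorem omegaTerm_eq {a l b c d e f g : ℂ} (hg : OmegaGeneric s h a l b c d e f g)
    (hl : b + c + d + l = 2 * a + h) (n k : ℕ) :
    omegaTerm s h n a b c d e f g k = omegaOuter s h n a l e f g k *
      ftValue s h k l (l + b - a) (l + c - a) (l + d - a) := by
  unfold omegaTerm omegaOuter ftValue
  rw [show l + h - (l + b - a) - (l + c - a) = d by linear_combination -hl,
    show l + h - (l + b - a) - (l + d - a) = c by linear_combination -hl,
    show l + h - (l + c - a) - (l + d - a) = b by linear_combination -hl,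
    show d - (l + d - a) = a - l by ring,
    show l + h - (l + b - a) = a + h - b by ring,
    show l + h - (l + c - a) = a + h - c by ring,
    show l + h - (l + d - a) = a + h - d by ring]
  have := hg.gen_al.addFac_ne (y := a - l) (0) (k) (by push_cast; ring)
  have := hg.gen_l.addFac_ne (y := l + h) (1) (k) (by push_cast; ring)
  have := hg.gen_ab.addFac_ne (y := a + h - b) (1) (k) (by push_cast; ring)
  have := hg.gen_ac.addFac_ne (y := a + h - c) (1) (k) (by push_cast; ring)
  have := hg.gen_ad.addFac_ne (y := a + h - d) (1) (k) (by push_cast; ring)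
  have := hg.gen_ae.addFac_ne (y := a + h - e) (1) (k) (by push_cast; ring)
  have := hg.gen_af.addFac_ne (y := a + h - f) (1) (k) (by push_cast; ring)
  have := hg.gen_ag.addFac_ne (y := a + h - g) (1) (k) (by push_cast; ring)
  have := hg.gen_a.addFac_ne (y := a + (n + 1) * h) (n + 1) (k) (by push_cast; ring)
  have := addFac_mul_self_ne hg.ne k
  have : s a ≠ 0 := hg.gen_a.ne 0 (by simp)
  simp only [mul_div_assoc', div_mul_eq_mul_div, div_div]
  rw [div_eq_div_iff (by repeat' first | assumption | apply mul_ne_zero)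
    (by repeat' first | assumption | apply mul_ne_zero)]
  ring

/-- With j fixed, the dependence on i is again a Frenkel–Turaev summand, now with leading parameter
a + 2jh; this allows the second evaluation. -/
theorem omegaOuter_mul_ftTerm (hs : IsOddTheta s) {a l b c d e f g : ℂ}
    (hg : OmegaGeneric s h a l b c d e f g) (j i M : ℕ) :
    omegaOuter s h (j + i + M) a l e f g (j + i) *
      ftTerm s h (j + i) l (l + b - a) (l + c - a) (l + d - a) (a + ((j + i : ℕ) : ℂ) * h) j =
    omegaInner s h j (i + M) a l b c d e f g *
      ftTerm s h (i + M) (a + 2 * j * h) (e + j * h) (f + j * h) (a - l) (g + j * h) i := by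
  unfold omegaOuter omegaInner ftTerm
  rw [show l + h - (l + b - a) = a + h - b by ring,
    show l + h - (l + c - a) = a + h - c by ring,
    show l + h - (l + d - a) = a + h - d by ring,
    show a + 2 * j * h + h - (e + j * h) = a + h - e + j * h by ring,
    show a + 2 * j * h + h - (f + j * h) = a + h - f + j * h by ring,
    show a + 2 * j * h + h - (g + j * h) = a + h - g + j * h by ring,
    show a + 2 * j * h + h - (a - l) = l + h + 2 * j * h by ring,
    show a + 2 * j * h + 2 * i * h = a + 2 * ((j + i : ℕ) : ℂ) * h by push_cast; ring,
    ← add_assoc j i M, show 2 * j + (i + M) = 2 * j + i + M by ring]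
  have n1 : s (a + 2 * j * h) ≠ 0 := hg.gen_a.ne (2 * j) (by push_cast; ring)
  have n2 : s a ≠ 0 := hg.gen_a.ne 0 (by simp)
  have n3 : s l ≠ 0 := hg.gen_l.ne 0 (by simp)
  have m1 := hg.gen_a.addFac_ne (y := a) 0 (j + i) (by simp)
  have m2 := hg.gen_l.addFac_ne (y := l + h) 1 (j + i) (by simp)
  have m3 := hg.gen_a.addFac_ne (y := a + h) 1 (j + i + M) (by simp)
  have e1 : addFac s h (a + ((j + i : ℕ) : ℂ) * h) j =
      addFac s h a (2 * j) * addFac s h (a + 2 * j * h) i / addFac s h a (j + i) := by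
    rw [eq_div_iff m1, mul_comm, ← addFac_add s (j + i) j rfl,
      ← addFac_add s (2 * j) i (by push_cast; ring)]
    congr 1
    ring
  have e2 : addFac s h (-((j + i : ℕ) : ℂ) * h) j = (-1) ^ j * addFac s h (h + i * h) j :=
    addFac_reflect hs j (by push_cast; ring)
  have e3 : addFac s h h (j + i) = addFac s h h i * addFac s h (h + i * h) j := by
    rw [add_comm, addFac_add s i j rfl]
  have e4 : addFac s h (l + h - (a + ((j + i : ℕ) : ℂ) * h)) j =
      (-1) ^ j * addFac s h (a - l + i * h) j :=
    addFac_reflect hs j (by push_cast; ring)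
  have e5 : addFac s h (a - l) (j + i) = addFac s h (a - l) i * addFac s h (a - l + i * h) j := by
    rw [add_comm, addFac_add s i j rfl]
  have e6 : addFac s h (l + (((j + i : ℕ) : ℂ) + 1) * h) j =
      addFac s h (l + h) (2 * j) * addFac s h (l + h + 2 * j * h) i / addFac s h (l + h) (j + i) := by
    rw [eq_div_iff m2, mul_comm, ← addFac_add s (j + i) j (by push_cast; ring),
      ← addFac_add s (2 * j) i (by push_cast; ring)]
    congr 1
    ring
  have e7 : addFac s h (-((j + i + M : ℕ) : ℂ) * h) (j + i) =
      (-1) ^ (j + i) * (addFac s h (h + M * h) i * addFac s h (h + (i + M) * h) j) := by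
    rw [addFac_reflect hs (j + i) (x := h + M * h) (by push_cast; ring), add_comm j i,
      addFac_add s i j (y := h + (i + M) * h) (by ring)]
  have e8 : addFac s h h (j + i + M) = addFac s h h (i + M) * addFac s h (h + (i + M) * h) j := by
    rw [show j + i + M = i + M + j by ring]
    exact addFac_add s (i + M) j (by push_cast; ring)
  have e9 : addFac s h (-((i + M : ℕ) : ℂ) * h) i = (-1) ^ i * addFac s h (h + M * h) i :=
    addFac_reflect hs i (by push_cast; ring)
  have e10 : addFac s h (a + (((j + i + M : ℕ) : ℂ) + 1) * h) (j + i) =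
      addFac s h (a + h) (2 * j + i + M) *
        addFac s h (a + 2 * j * h + (((i + M : ℕ) : ℂ) + 1) * h) i /
        addFac s h (a + h) (j + i + M) := by
    rw [eq_div_iff m3, mul_comm, ← addFac_add s (j + i + M) (j + i) (by push_cast; ring),
      ← addFac_add s (2 * j + i + M) i (by push_cast; ring)]
    congr 1
    ring
  have e11 := addFac_add s (h := h) (x := e) j i rfl
  have e12 := addFac_add s (h := h) (x := f) j i rfl
  have e13 := addFac_add s (h := h) (x := g) j i rfl
  have e14 := addFac_add s (h := h) (x := a + h - e) j i rfl
  have e15 := addFac_add s (h := h) (x := a + h - f) j i rfl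
  have e16 := addFac_add s (h := h) (x := a + h - g) j i rfl
  have p1 : ((-1) ^ j : ℂ) ≠ 0 := pow_ne_zero _ (by norm_num)
  have p2 : (-1 : ℂ) ^ (j + i) = (-1) ^ j * (-1) ^ i := pow_add _ _ _
  have r1 := addFac_mul_self_ne hg.ne (j + i)
  rw [e3] at r1
  have r2 := left_ne_zero_of_mul r1
  have r3 := right_ne_zero_of_mul r1
  clear r1
  have r4 := addFac_mul_self_ne hg.ne j
  have r5 := addFac_mul_self_ne hg.ne (i + M)
  have := hg.gen_ae.addFac_ne (y := a + h - e) (1) (j) (by push_cast; ring)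
  have := hg.gen_ae.addFac_ne (y := a + h - e + j * h) (1 + j) (i) (by push_cast; ring)
  have := hg.gen_af.addFac_ne (y := a + h - f) (1) (j) (by push_cast; ring)
  have := hg.gen_af.addFac_ne (y := a + h - f + j * h) (1 + j) (i) (by push_cast; ring)
  have := hg.gen_ag.addFac_ne (y := a + h - g) (1) (j) (by push_cast; ring)
  have := hg.gen_ag.addFac_ne (y := a + h - g + j * h) (1 + j) (i) (by push_cast; ring)
  have := hg.gen_a.addFac_ne (y := a + h) (1) (2 * j + i + M) (by push_cast; ring)
  have := hg.gen_a.addFac_ne (y := a + 2 * j * h + (((i + M : ℕ) : ℂ) + 1) * h) (2 * j + i + M + 1) (i) (by push_cast; ring)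
  have := hg.gen_al.addFac_ne (y := a - l + i * h) (i) (j) (by push_cast; ring)
  have := hg.gen_l.addFac_ne (y := l + h) (1) (2 * j) (by push_cast; ring)
  have := hg.gen_l.addFac_ne (y := l + h + 2 * j * h) (1 + 2 * j) (i) (by push_cast; ring)
  have := hg.gen_ab.addFac_ne (y := a + h - b) (1) (j) (by push_cast; ring)
  have := hg.gen_ac.addFac_ne (y := a + h - c) (1) (j) (by push_cast; ring)
  have := hg.gen_ad.addFac_ne (y := a + h - d) (1) (j) (by push_cast; ring)
  rw [e1, e2, e3, e4, e5, e6, e7, e8, e9, e10, e11, e12, e13, e14, e15, e16, p2]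
  simp only [mul_div_assoc', div_mul_eq_mul_div, div_div, div_div_eq_mul_div]
  rw [div_eq_div_iff (by repeat' first | assumption | apply mul_ne_zero)
    (by repeat' first | assumption | apply mul_ne_zero)]
  ring

theorem omegaInner_mul_ftValue (hs : IsOddTheta s) {a l b c d e f g : ℂ}
    (hg : OmegaGeneric s h a l b c d e f g) (j N : ℕ)
    (hbal : e + f + g = a + l + (j + N + 1) * h) :
    omegaInner s h j N a l b c d e f g *
      ftValue s h N (a + 2 * j * h) (e + j * h) (f + j * h) (a - l) =
    omegaPre s h (j + N) a l e f *
      omegaTerm s h (j + N) l (l + b - a) (l + c - a) (l + d - a) e f g j := by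
  unfold omegaInner omegaPre omegaTerm ftValue
  rw [show a + 2 * j * h + h - (e + j * h) = a + h - e + j * h by ring,
    show a + 2 * j * h + h - (f + j * h) = a + h - f + j * h by ring,
    show a + h - e + j * h - (f + j * h) = a + h - e - f by ring,
    show a + h - e + j * h - (a - l) = l + h - e + j * h by ring,
    show a + h - f + j * h - (a - l) = l + h - f + j * h by ring,
    show a + h - e - f - (a - l) = l + h - e - f by ring,
    show a + 2 * j * h + h - (a - l) = l + h + 2 * j * h by ring,
    show a + 2 * j * h + h = a + h + 2 * j * h by ring,
    show l + h - (l + b - a) = a + h - b by ring,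
    show l + h - (l + c - a) = a + h - c by ring,
    show l + h - (l + d - a) = a + h - d by ring]
  have n2 : s a ≠ 0 := hg.gen_a.ne 0 (by simp)
  have n1 : s (a + 2 * j * h) ≠ 0 := hg.gen_a.ne (2 * j) (by push_cast; ring)
  have n3 : s l ≠ 0 := hg.gen_l.ne 0 (by simp)
  have e1 : addFac s h a (2 * j) = s a * addFac s h (a + h) (2 * j) / s (a + 2 * j * h) := by
    rw [eq_div_iff n1]
    exact addFac_mul_right s (2 * j) rfl (by push_cast; ring)
  have e2 := addFac_add s (h := h) (x := a + h) (2 * j) N (y := a + h + 2 * j * h)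
    (by push_cast; ring)
  have e3 := addFac_add s (h := h) (x := a + h - e) j N rfl
  have e4 := addFac_add s (h := h) (x := a + h - f) j N rfl
  have e5 := addFac_add s (h := h) (x := l + h - e) j N rfl
  have e6 := addFac_add s (h := h) (x := l + h - f) j N rfl
  have e7 : addFac s h (l + (((j + N : ℕ) : ℂ) + 1) * h) j =
      addFac s h (l + h) (2 * j) * addFac s h (l + h + 2 * j * h) N / addFac s h (l + h) (j + N) := by
    rw [eq_div_iff (hg.gen_l.addFac_ne 1 _ (by simp)), mul_comm,
      ← addFac_add s (j + N) j (by push_cast; ring), ← addFac_add s (2 * j) N (by push_cast; ring)]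
    congr 1
    ring
  have e8 : addFac s h (-((j + N : ℕ) : ℂ) * h) j = (-1) ^ j * addFac s h (h + N * h) j :=
    addFac_reflect hs j (by push_cast; ring)
  have e9 : addFac s h h (j + N) = addFac s h h N * addFac s h (h + N * h) j := by
    rw [add_comm, addFac_add s N j rfl]
  have e10 : addFac s h (l + h - g) j = (-1) ^ j * addFac s h (a + h - e - f + N * h) j :=
    addFac_reflect hs j (by linear_combination -hbal)
  have e11 : addFac s h (a + h - g) j = (-1) ^ j * addFac s h (l + h - e - f + N * h) j :=
    addFac_reflect hs j (by linear_combination -hbal)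
  have e12 : addFac s h (a + h - e - f) (j + N) =
      addFac s h (a + h - e - f) N * addFac s h (a + h - e - f + N * h) j := by
    rw [add_comm j N, addFac_add s N j rfl]
  have e13 : addFac s h (l + h - e - f) (j + N) =
      addFac s h (l + h - e - f) N * addFac s h (l + h - e - f + N * h) j := by
    rw [add_comm j N, addFac_add s N j rfl]
  have p1 : ((-1) ^ j : ℂ) ≠ 0 := pow_ne_zero _ (by norm_num)
  have r4 := addFac_mul_self_ne hg.ne j
  have r5 := addFac_mul_self_ne hg.ne N
  have hlef : Generic s h (l - e - f) :=
    hg.gen_ag.neg hs (-(j + N + 1)) (by push_cast; linear_combination -hbal)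
  have haef : Generic s h (a - e - f) :=
    hg.gen_lg.neg hs (-(j + N + 1)) (by push_cast; linear_combination -hbal)
  have := hlef.addFac_ne (y := l + h - e - f) 1 N (by push_cast; ring)
  have := hlef.addFac_ne (y := l + h - e - f + N * h) (1 + N) j (by push_cast; ring)
  have := haef.addFac_ne (y := a + h - e - f + N * h) (1 + N) j (by push_cast; ring)
  have := hg.gen_ae.addFac_ne (y := a + h - e) (1) (j) (by push_cast; ring)
  have := hg.gen_ae.addFac_ne (y := a + h - e + j * h) (1 + j) (N) (by push_cast; ring)
  have := hg.gen_af.addFac_ne (y := a + h - f) (1) (j) (by push_cast; ring)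
  have := hg.gen_af.addFac_ne (y := a + h - f + j * h) (1 + j) (N) (by push_cast; ring)
  have := hg.gen_le.addFac_ne (y := l + h - e) (1) (j) (by push_cast; ring)
  have := hg.gen_lf.addFac_ne (y := l + h - f) (1) (j) (by push_cast; ring)
  have := hg.gen_a.addFac_ne (y := a + h) (1) (2 * j) (by push_cast; ring)
  have := hg.gen_a.addFac_ne (y := a + h + 2 * j * h) (1 + 2 * j) (N) (by push_cast; ring)
  have := hg.gen_l.addFac_ne (y := l + h) (1) (2 * j) (by push_cast; ring)
  have := hg.gen_l.addFac_ne (y := l + h) (1) (j + N) (by push_cast; ring)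
  have := hg.gen_l.addFac_ne (y := l + h + 2 * j * h) (1 + 2 * j) (N) (by push_cast; ring)
  have := hg.gen_ab.addFac_ne (y := a + h - b) (1) (j) (by push_cast; ring)
  have := hg.gen_ac.addFac_ne (y := a + h - c) (1) (j) (by push_cast; ring)
  have := hg.gen_ad.addFac_ne (y := a + h - d) (1) (j) (by push_cast; ring)
  rw [e1, e2, e3, e4, e5, e6, e7, e8, e9, e10, e11, e12, e13]
  simp only [mul_div_assoc', div_mul_eq_mul_div, div_div, div_div_eq_mul_div]
  rw [div_eq_div_iff (by repeat' first | assumption | apply mul_ne_zero)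
    (by repeat' first | assumption | apply mul_ne_zero)]
  ring

/-- The elliptic Bailey transformation of terminating very-well-poised series, for generic
parameters. -/
theorem sum_omegaTerm (hs : IsOddTheta s) {a l b c d e f g : ℂ}
    (hg : OmegaGeneric s h a l b c d e f g) (n : ℕ) (hl : b + c + d + l = 2 * a + h)
    (hbal : e + f + g = a + l + (n + 1) * h) :
    ∑ k ∈ Finset.range (n + 1), omegaTerm s h n a b c d e f g k =
      omegaPre s h n a l e f * ∑ j ∈ Finset.range (n + 1),
        omegaTerm s h n l (l + b - a) (l + c - a) (l + d - a) e f g j := by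
  have hexp : ∀ k ∈ Finset.range (n + 1), omegaTerm s h n a b c d e f g k =
      ∑ j ∈ Finset.range (k + 1), omegaOuter s h n a l e f g (j + (k - j)) *
        ftTerm s h (j + (k - j)) l (l + b - a) (l + c - a) (l + d - a)
          (a + ((j + (k - j) : ℕ) : ℂ) * h) j := by
    intro k _
    have hk : ∀ j ∈ Finset.range (k + 1), omegaOuter s h n a l e f g (j + (k - j)) *
        ftTerm s h (j + (k - j)) l (l + b - a) (l + c - a) (l + d - a)
          (a + ((j + (k - j) : ℕ) : ℂ) * h) j = omegaOuter s h n a l e f g k *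
        ftTerm s h k l (l + b - a) (l + c - a) (l + d - a) (a + k * h) j := fun j hj => by
      rw [show j + (k - j) = k by have := Finset.mem_range.1 hj; omega]
    rw [Finset.sum_congr rfl hk, ← Finset.mul_sum, omegaTerm_eq hg hl,
      sum_ftTerm hs hg.ne k hg.gen_l (hg.gen_ab.shift 0 (by push_cast; ring))
        (hg.gen_ac.shift 0 (by push_cast; ring)) (hg.gen_ad.shift 0 (by push_cast; ring))
        (hg.gen_al.neg hs (-k) (by push_cast; ring)) (by linear_combination hl)]
  rw [Finset.sum_congr rfl hexp, Finset.sum_range_diag_flip (n + 1) fun j i =>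
    omegaOuter s h n a l e f g (j + i) *
        ftTerm s h (j + i) l (l + b - a) (l + c - a) (l + d - a)
          (a + ((j + i : ℕ) : ℂ) * h) j, Finset.mul_sum]
  refine Finset.sum_congr rfl fun j hj => ?_
  obtain ⟨N, rfl⟩ : ∃ N, n = j + N := ⟨n - j, by have := Finset.mem_range.1 hj; omega⟩
  push_cast at hbal
  -- The second balancing condition, on e + f + g, is exactly the balancing of this inner sum.
  rw [← omegaInner_mul_ftValue hs hg j N hbal, ← sum_ftTerm hs hg.ne N (e := g + j * h)
    (hg.gen_a.shift (2 * j) (by push_cast; ring)) (hg.gen_ae.shift j (by push_cast; ring))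
    (hg.gen_af.shift j (by push_cast; ring)) (hg.gen_l.shift (2 * j) (by push_cast; ring))
    (hg.gen_ag.shift j (by push_cast; ring)) (by linear_combination hbal), Finset.mul_sum,
    show j + N + 1 - j = N + 1 by omega]
  refine Finset.sum_congr rfl fun i hi => ?_
  obtain ⟨M, rfl⟩ : ∃ M, N = i + M := ⟨N - i, by have := Finset.mem_range.1 hi; omega⟩
  rw [← add_assoc, omegaOuter_mul_ftTerm hs hg]

end

/-! ### The cubic transformation with g = a/e -/

section

variable {s : ℂ → ℂ} {h : ℂ}

/-- The Bailey transformation shifts the parameters in slots b, c, d and keeps those in e, f, g;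
this permutation moves the parameters involving g into the shifted slots. -/
theorem omegaTerm_perm (s : ℂ → ℂ) (h : ℂ) (n : ℕ) (a b c d e f g : ℂ) (k : ℕ) :
    omegaTerm s h n a b c d e f g k = omegaTerm s h n a c g d b e f k := by
  unfold omegaTerm
  congr 2 <;> ring

/-- The additional genericity conditions used for `g = a / e`. -/
structure CubicGeneric' (s : ℂ → ℂ) (h a b c d e : ℂ) : Prop
    extends CubicGeneric s h a b c d e where
  gen_c : Generic s h c
  gen_be : Generic s h (b - e)
  gen_abe : Generic s h (a + b - e)
  gen_ace : Generic s h (2 * a - c - e)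

/-- The cubic transformation with `g = a / e`, for generic parameters. -/
theorem sum_cubic_eq_of_ae (hs : IsOddTheta s) {a b c d e f : ℂ}
    (hg : CubicGeneric' s h a b c d e) (n : ℕ) (hd : b + c + d = a + h)
    (hf : e + f = 2 * a + (2 * n + 1) * h) :
    ∑ k ∈ Finset.range (n + 1), cubicWeight s h a b c d k * cubicFactor s h n a e f k =
      cubicPre s h n a b c d e (a - e) * ∑ j ∈ Finset.range (n + 1),
        omegaTerm s (2 * h) n (a + (a - e) - c) (a - c) (a - e + 2 * h - c) (b + e + (a - e) - a)
          d f (a - e) j := by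
  have hog : OmegaGeneric s (2 * h) (a + (a - b) - c) (a + (a - e) - c) (a - b + 2 * h - c) (a - b)
      (b + e + (a - b) - a) (a - c) d f := by
    constructor
    · exact hg.ne_two_mul
    · exact hg.gen_apd.two_mul (-1) (by push_cast; linear_combination -hd)
    · exact hg.gen_ace.two_mul 0 (by push_cast; ring)
    · exact (hg.gen_be.neg hs (y := e - b) 0 (by push_cast; ring)).two_mul 0 (by push_cast; ring)
    · exact hg.gen_a.two_mul (-2) (by push_cast; ring)
    · exact hg.gen_ac.two_mul 0 (by push_cast; ring)
    · exact hg.gen_apde.two_mul (-1) (by push_cast; linear_combination -hd)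
    · exact hg.gen_ab.two_mul 0 (by push_cast; ring)
    · exact hg.gen_a.two_mul (-1) (by push_cast; linear_combination -hd)
    · exact (hg.gen_ade.neg hs (y := a + d - f) (-(2 * n + 1))
        (by push_cast; linear_combination -hf)).two_mul (-1) (by push_cast; linear_combination -hd)
    · exact hg.gen_ae.two_mul 0 (by push_cast; ring)
    · exact hg.gen_abe.two_mul (-1) (by push_cast; linear_combination -hd)
    · exact (hg.gen_c.neg hs (y := 2 * a - c - e - f) (-(2 * n + 1))
        (by push_cast; linear_combination -hf)).two_mul 0 (by push_cast; ring)
  -- The shift is (a - e) - (a - b) = b - e: it replaces a - b by a - e wherever g enters the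
  -- parameters.
  have hbailey := sum_omegaTerm hs hog n (by ring) (by linear_combination hd + hf)
  rw [sum_cubic_eq_of_ab hs hg.toCubicGeneric n hd hf]
  simp only [omegaTerm_perm s (2 * h) n (a + (a - b) - c) (a - c)]
  rw [hbailey, ← mul_assoc]
  simp only [omegaTerm_perm s (2 * h) n (a + (a - e) - c) (a - c)]
  rw [show a + (a - e) - c + (a - b + 2 * h - c) - (a + (a - b) - c) = a - e + 2 * h - c by ring,
    show a + (a - e) - c + (a - b) - (a + (a - b) - c) = a - e by ring,
    show a + (a - e) - c + (b + e + (a - b) - a) - (a + (a - b) - c) = b + e + (a - e) - a by ring]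
  -- The series agree; it remains to compare the prefactors.
  congr 1
  unfold cubicPre omegaPre
  rw [show 2 * a + 2 * h - b - d - e - (a - b) = a + 2 * h - d - e by ring,
    show 2 * a + 2 * h - b - d - e - (a - e) = a + 2 * h - b - d by ring,
    show 2 * a + 2 * h - b - e - (a - b) = a + 2 * h - e by ring,
    show 2 * a + 2 * h - b - e - (a - e) = a + 2 * h - b by ring,
    show a + (a - b) - c + 2 * h - (a - c) - d = a + 2 * h - b - d by ring,
    show a + (a - e) - c + 2 * h - (a - c) - d = a + 2 * h - d - e by ring,
    show a + (a - b) - c + 2 * h - (a - c) = a + 2 * h - b by ring,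
    show a + (a - e) - c + 2 * h - (a - c) = a + 2 * h - e by ring,
    show a + (a - b) - c + 2 * h = a + (a - b) + 2 * h - c by ring,
    show a + (a - e) - c + 2 * h = a + (a - e) + 2 * h - c by ring]
  have := hg.gen_ae.addFac_two_mul_ne (y := a + 2 * h - e) 2 n (by push_cast; ring)
  have := hg.gen_ab.addFac_two_mul_ne (y := a + 2 * h - b) 2 n (by push_cast; ring)
  have := hg.gen_ad.addFac_two_mul_ne (y := a + 2 * h - d) 2 n (by push_cast; ring)
  have := hg.gen_ade.addFac_two_mul_ne (y := a + 2 * h - d - e) 2 n (by push_cast; ring)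
  have := hg.gen_ace.addFac_two_mul_ne (y := a + (a - e) + 2 * h - c) 2 n (by push_cast; ring)
  have := hg.gen_apd.addFac_two_mul_ne (y := a + (a - b) + 2 * h - c) 1 n
    (by push_cast; linear_combination -hd)
  have := hg.gen_ae.addFac_two_mul_ne (y := 2 * a + 2 * h - b - c - d - e) 1 n
    (by push_cast; linear_combination -hd)
  have := hg.gen_a.addFac_two_mul_ne (y := a + (a - b) + 2 * h - c - d) 1 n
    (by push_cast; linear_combination -hd)
  rw [div_mul_div_comm, div_eq_div_iff (by repeat' first | assumption | apply mul_ne_zero)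
    (by repeat' first | assumption | apply mul_ne_zero)]
  ring

end

/-- The cubic transformation for generic parameters. -/
theorem sum_cubic_eq {s : ℂ → ℂ} {h : ℂ} (hs : IsOddTheta s) {a b c d e f g : ℂ}
    (hg : CubicGeneric' s h a b c d e) (n : ℕ) (hd : b + c + d = a + h)
    (hf : e + f = 2 * a + (2 * n + 1) * h) (hgg : g = a - b ∨ g = a - e) :
    ∑ k ∈ Finset.range (n + 1), cubicWeight s h a b c d k * cubicFactor s h n a e f k =
      cubicPre s h n a b c d e g * ∑ j ∈ Finset.range (n + 1),
        omegaTerm s (2 * h) n (a + g - c) (a - c) (g + 2 * h - c) (b + e + g - a) d f g j := by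
  rcases hgg with rfl | rfl
  · exact sum_cubic_eq_of_ab hs hg.toCubicGeneric n hd hf
  · exact sum_cubic_eq_of_ae hs hg n hd hf

/-! ### Removing the genericity conditions by continuity -/

theorem isOddTheta_oddTheta {p : ℂ} (hp : ‖p‖ < 1) : IsOddTheta (oddTheta p) :=
  ⟨oddTheta_neg hp, oddTheta_three_term hp⟩

/-- A shorter factorial divides a longer one, so nonvanishing at n covers the denominators of all
terms. -/
theorem addFac_ne_zero_of_le {s : ℂ → ℂ} {h x : ℂ} {k n : ℕ} (hk : k ≤ n)
    (hn : addFac s h x n ≠ 0) : addFac s h x k ≠ 0 :=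
  Finset.prod_ne_zero_iff.2 fun i hi => Finset.prod_ne_zero_iff.1 hn i
    (Finset.mem_range.2 ((Finset.mem_range.1 hi).trans_le hk))

@[fun_prop]
theorem continuous_addFac {s : ℂ → ℂ} (hs : Continuous s) {h x : ℂ → ℂ} (hh : Continuous h)
    (hx : Continuous x) (k : ℕ) : Continuous fun t => addFac s (h t) (x t) k := by
  unfold addFac
  fun_prop

section

variable {s : ℂ → ℂ} {h a b c d e f g : ℂ → ℂ}

theorem continuousAt_cubicWeight (hs : Continuous s) (hh : Continuous h)
    (ha : Continuous a) (hb : Continuous b) (hc : Continuous c) (hd : Continuous d) (k : ℕ) {t : ℂ}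
    (h0 : s (a t) ≠ 0) (h1 : addFac s (2 * h t) (a t + 2 * h t - b t) k ≠ 0)
    (h2 : addFac s (2 * h t) (a t + 2 * h t - c t) k ≠ 0)
    (h3 : addFac s (2 * h t) (a t + 2 * h t - d t) k ≠ 0) :
    ContinuousAt (fun t => cubicWeight s (h t) (a t) (b t) (c t) (d t) k) t := by
  unfold cubicWeight
  refine (ContinuousAt.div (g := fun t => s (a t)) ?_ ?_ h0).mul (ContinuousAt.div ?_ ?_
    (mul_ne_zero (mul_ne_zero h1 h2) h3))
  all_goals exact Continuous.continuousAt (by fun_prop (disch := assumption))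

theorem continuousAt_cubicFactor (hs : Continuous s) (hh : Continuous h)
    (ha : Continuous a) (he : Continuous e) (hf : Continuous f) (n k : ℕ) {t : ℂ}
    (h1 : addFac s (h t) (a t + h t - e t) k ≠ 0)
    (h2 : addFac s (h t) (a t + h t - f t) k ≠ 0)
    (h3 : addFac s (h t) (a t + (2 * n + 1) * h t) k ≠ 0) :
    ContinuousAt (fun t => cubicFactor s (h t) n (a t) (e t) (f t) k) t := by
  unfold cubicFactor
  refine ContinuousAt.div ?_ ?_ (mul_ne_zero (mul_ne_zero h1 h2) h3)
  all_goals exact Continuous.continuousAt (by fun_prop (disch := assumption))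

theorem continuousAt_cubicPre (hs : Continuous s) (hh : Continuous h)
    (ha : Continuous a) (hb : Continuous b) (hc : Continuous c) (hd : Continuous d)
    (he : Continuous e) (hg : Continuous g) (n : ℕ) {t : ℂ}
    (h1 : addFac s (2 * h t) (2 * a t + 2 * h t - b t - e t - g t) n ≠ 0)
    (h2 : addFac s (2 * h t) (a t + g t + 2 * h t - c t) n ≠ 0)
    (h3 : addFac s (2 * h t) (a t + 2 * h t - d t) n ≠ 0)
    (h4 : addFac s (2 * h t) (2 * a t + 2 * h t - b t - c t - d t - e t) n ≠ 0) :
    ContinuousAt (fun t => cubicPre s (h t) n (a t) (b t) (c t) (d t) (e t) (g t)) t := by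
  unfold cubicPre
  refine ContinuousAt.div ?_ ?_ (mul_ne_zero (mul_ne_zero (mul_ne_zero h1 h2) h3) h4)
  all_goals exact Continuous.continuousAt (by fun_prop (disch := assumption))

theorem continuousAt_omegaTerm (hs : Continuous s) (hh : Continuous h)
    (ha : Continuous a) (hb : Continuous b) (hc : Continuous c) (hd : Continuous d)
    (he : Continuous e) (hf : Continuous f) (hg : Continuous g) (n k : ℕ) {t : ℂ}
    (h0 : s (a t) ≠ 0) (h1 : addFac s (h t) (h t) k ≠ 0)
    (h2 : addFac s (h t) (a t + h t - b t) k ≠ 0)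
    (h3 : addFac s (h t) (a t + h t - c t) k ≠ 0)
    (h4 : addFac s (h t) (a t + h t - d t) k ≠ 0)
    (h5 : addFac s (h t) (a t + h t - e t) k ≠ 0)
    (h6 : addFac s (h t) (a t + h t - f t) k ≠ 0)
    (h7 : addFac s (h t) (a t + h t - g t) k ≠ 0)
    (h8 : addFac s (h t) (a t + (n + 1) * h t) k ≠ 0) :
    ContinuousAt (fun t => omegaTerm s (h t) n (a t) (b t) (c t) (d t) (e t) (f t) (g t) k) t := by
  unfold omegaTerm
  refine (ContinuousAt.div (g := fun t => s (a t)) ?_ ?_ h0).mul (ContinuousAt.div ?_ ?_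
    (by repeat' first | assumption | apply mul_ne_zero))
  all_goals exact Continuous.continuousAt (by fun_prop (disch := assumption))

end

/-- For all but countably many `t`, the line `c + t * w` is generic, provided that `w` is not a
multiple of the slope of the step. -/
theorem countable_not_generic {p : ℂ} (hp : ‖p‖ < 1) (c h : ℂ) {w r : ℤ}
    (hw : ∀ m : ℤ, w + m * r ≠ 0) :
    {t : ℂ | ¬ Generic (oddTheta p) (h + t * r) (c + t * w)}.Countable := by
  -- For each m the bad t are zeros along a line of slope w + m r, which is nonzero by hypothesis.
  have : {t : ℂ | ¬ Generic (oddTheta p) (h + t * r) (c + t * w)} =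
      ⋃ m : ℤ, {t : ℂ | oddTheta p ((c + m * h) + t * ((w + m * r : ℤ) : ℂ)) = 0} := by
    ext t
    simp only [Generic, Set.mem_iUnion, Set.mem_ofPred_eq, not_forall, not_not]
    refine exists_congr fun m => ?_
    rw [show c + t * w + m * (h + t * r) = (c + m * h) + t * ((w + m * r : ℤ) : ℂ) by
      push_cast; ring]
  rw [this]
  exact Set.countable_iUnion fun m => countable_oddTheta_affine_eq_zero hp _
    (by exact_mod_cast hw m)

theorem countable_not_generic_zero {p : ℂ} (hp : ‖p‖ < 1) (h : ℂ) {r : ℤ} (hr : r ≠ 0) :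
    {t : ℂ | ¬ ∀ m : ℤ, m ≠ 0 → oddTheta p (m * (h + t * r)) ≠ 0}.Countable := by
  have : {t : ℂ | ¬ ∀ m : ℤ, m ≠ 0 → oddTheta p (m * (h + t * r)) ≠ 0} ⊆
      ⋃ m : {m : ℤ // m ≠ 0}, {t : ℂ | oddTheta p (m * h + t * ((m * r : ℤ) : ℂ)) = 0} := by
    intro t
    simp only [Set.mem_iUnion, Set.mem_ofPred_eq, not_forall, not_not]
    rintro ⟨m, hm, h0⟩
    refine ⟨⟨m, hm⟩, ?_⟩
    rw [← h0]
    congr 1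
    push_cast
    ring
  refine Set.Countable.mono this (Set.countable_iUnion fun m => ?_)
  exact countable_oddTheta_affine_eq_zero hp _ (by exact_mod_cast mul_ne_zero m.2 hr)

/-- Any parameters are limits of generic parameters. -/
theorem dense_cubicGeneric {p : ℂ} (hp : ‖p‖ < 1) (a b c e h : ℂ) :
    Dense {t : ℂ | CubicGeneric' (oddTheta p) (h + t * 100) (a + t * 27) (b + t * 1) (c + t * 3)
      ((a + t * 27) + (h + t * 100) - (b + t * 1) - (c + t * 3)) (e + t * 9)} := by
  -- The slopes 100, 27, 1, 3, 9 are chosen so that none of the thirteen combinations below has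
  -- slope divisible by 100; then no multiple of the step can cancel the dependence on t.
  have key : ∀ (w : ℤ) (y : ℂ), (∀ m : ℤ, w + m * 100 ≠ 0) →
      {t : ℂ | ¬ Generic (oddTheta p) (h + t * 100) (y + t * w)}.Countable := fun w y hw => by
    simpa using countable_not_generic hp y h hw
  have hz := countable_not_generic_zero hp h (r := 100) (by norm_num)
  push_cast at hz
  have k1 := key 27 a (by omega)
  have k2 := key 123 (a + h - b - c) (by omega)
  have k3 := key 26 (a - b) (by omega)
  have k4 := key 24 (a - c) (by omega)
  have k5 := key (-96) (b + c - h) (by omega)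
  have k6 := key 18 (a - e) (by omega)
  have k7 := key 150 (2 * a + h - b - c) (by omega)
  have k8 := key 141 (2 * a + h - b - c - e) (by omega)
  have k9 := key (-105) (b + c - h - e) (by omega)
  have k10 := key 3 c (by omega)
  have k11 := key (-8) (b - e) (by omega)
  have k12 := key 19 (a + b - e) (by omega)
  have k13 := key 42 (2 * a - c - e) (by omega)
  have hc := ((((((((((((hz.union k1).union k2).union k3).union k4).union k5).union k6).union
    k7).union k8).union k9).union k10).union k11).union k12).union k13
  refine (hc.dense_compl ℂ).mono fun t ht => ?_
  simp only [Set.mem_compl_iff, Set.mem_union, not_or, Set.mem_ofPred_eq, not_not] at ht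
  obtain ⟨⟨⟨⟨⟨⟨⟨⟨⟨⟨⟨⟨⟨g0, g1⟩, g2⟩, g3⟩, g4⟩, g5⟩, g6⟩, g7⟩, g8⟩, g9⟩, g10⟩, g11⟩, g12⟩, g13⟩ := ht
  refine ⟨⟨g0, ?_, ?_, ?_, ?_, ?_, ?_, ?_, ?_, ?_⟩, ?_, ?_, ?_, ?_⟩
  · convert g1 using 1; push_cast; ring
  · convert g2 using 1; push_cast; ring
  · convert g3 using 1; push_cast; ring
  · convert g4 using 1; push_cast; ring
  · convert g5 using 1; push_cast; ring
  · convert g6 using 1; push_cast; ring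
  · convert g7 using 1; push_cast; ring
  · convert g8 using 1; push_cast; ring
  · convert g9 using 1; push_cast; ring
  · convert g10 using 1; push_cast; ring
  · convert g11 using 1; push_cast; ring
  · convert g12 using 1; push_cast; ring
  · convert g13 using 1; push_cast; ring

theorem eq_of_continuousAt_of_dense {F G : ℂ → ℂ} {t : ℂ} (hF : ContinuousAt F t)
    (hG : ContinuousAt G t) {S : Set ℂ} (hS : Dense S) (h : ∀ x ∈ S, F x = G x) : F t = G t := by
  have : (𝓝[S] t).NeBot := mem_closure_iff_nhdsWithin_neBot.1 (hS t)
  refine tendsto_nhds_unique (l := 𝓝[S] t) (hF.mono_left nhdsWithin_le_nhds)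
    ((hG.mono_left nhdsWithin_le_nhds).congr' ?_)
  filter_upwards [self_mem_nhdsWithin] with x hx using (h x hx).symm

/-- The cubic transformation in additive notation, as long as no denominator vanishes. -/
theorem sum_cubic_eq_of_ne_zero {p : ℂ} (hp : ‖p‖ < 1) {h a b c d e f g : ℂ} (n : ℕ)
    (hd : b + c + d = a + h) (hf : e + f = 2 * a + (2 * n + 1) * h) (hgg : g = a - b ∨ g = a - e)
    (hL₀ : oddTheta p a ≠ 0)
    (hL₁ : addFac (oddTheta p) (2 * h) (a + 2 * h - b) n ≠ 0)
    (hL₂ : addFac (oddTheta p) (2 * h) (a + 2 * h - c) n ≠ 0)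
    (hL₃ : addFac (oddTheta p) (2 * h) (a + 2 * h - d) n ≠ 0)
    (hL₄ : addFac (oddTheta p) h (a + h - e) n ≠ 0)
    (hL₅ : addFac (oddTheta p) h (a + h - f) n ≠ 0)
    (hL₆ : addFac (oddTheta p) h (a + (2 * n + 1) * h) n ≠ 0)
    (hR₁ : addFac (oddTheta p) (2 * h) (2 * a + 2 * h - b - e - g) n ≠ 0)
    (hR₂ : addFac (oddTheta p) (2 * h) (a + g + 2 * h - c) n ≠ 0)
    (hR₃ : addFac (oddTheta p) (2 * h) (2 * a + 2 * h - b - c - d - e) n ≠ 0)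
    (hω₀ : oddTheta p (a + g - c) ≠ 0)
    (hω₁ : addFac (oddTheta p) (2 * h) (2 * h) n ≠ 0)
    (hω₂ : addFac (oddTheta p) (2 * h) (a + g - c + 2 * h - (a - c)) n ≠ 0)
    (hω₃ : addFac (oddTheta p) (2 * h) (a + g - c + 2 * h - (g + 2 * h - c)) n ≠ 0)
    (hω₄ : addFac (oddTheta p) (2 * h) (a + g - c + 2 * h - (b + e + g - a)) n ≠ 0)
    (hω₅ : addFac (oddTheta p) (2 * h) (a + g - c + 2 * h - d) n ≠ 0)
    (hω₆ : addFac (oddTheta p) (2 * h) (a + g - c + 2 * h - f) n ≠ 0)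
    (hω₇ : addFac (oddTheta p) (2 * h) (a + g - c + 2 * h - g) n ≠ 0)
    (hω₈ : addFac (oddTheta p) (2 * h) (a + g - c + (n + 1) * (2 * h)) n ≠ 0) :
    ∑ k ∈ Finset.range (n + 1),
        cubicWeight (oddTheta p) h a b c d k * cubicFactor (oddTheta p) h n a e f k =
      cubicPre (oddTheta p) h n a b c d e g * ∑ j ∈ Finset.range (n + 1),
        omegaTerm (oddTheta p) (2 * h) n (a + g - c) (a - c) (g + 2 * h - c) (b + e + g - a)
          d f g j := by
  -- Here a, b, c, e, h move freely, while d, f, g are defined by the constraints, so the balancing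
  -- conditions and the chosen form of g persist for every t.
  obtain ⟨G, hG, hGc, rfl⟩ : ∃ G : ℂ → ℂ, (∀ t, G t = (a + t * 27) - (b + t * 1) ∨
      G t = (a + t * 27) - (e + t * 9)) ∧ Continuous G ∧ g = G 0 := by
    rcases hgg with rfl | rfl
    · exact ⟨fun t => (a + t * 27) - (b + t * 1), fun t => .inl rfl, by fun_prop, by simp⟩
    · exact ⟨fun t => (a + t * 27) - (e + t * 9), fun t => .inr rfl, by fun_prop, by simp⟩
  obtain ⟨H, hH, hH0, hHc⟩ : ∃ H : ℂ → ℂ, (∀ t, H t = h + t * 100) ∧ h = H 0 ∧ Continuous H :=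
    ⟨fun t => h + t * 100, fun _ => rfl, by simp, by fun_prop⟩
  obtain ⟨A, hA, hA0, hAc⟩ : ∃ A : ℂ → ℂ, (∀ t, A t = a + t * 27) ∧ a = A 0 ∧ Continuous A :=
    ⟨fun t => a + t * 27, fun _ => rfl, by simp, by fun_prop⟩
  obtain ⟨B, hB, hB0, hBc⟩ : ∃ B : ℂ → ℂ, (∀ t, B t = b + t * 1) ∧ b = B 0 ∧ Continuous B :=
    ⟨fun t => b + t * 1, fun _ => rfl, by simp, by fun_prop⟩
  obtain ⟨C, hC, hC0, hCc⟩ : ∃ C : ℂ → ℂ, (∀ t, C t = c + t * 3) ∧ c = C 0 ∧ Continuous C :=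
    ⟨fun t => c + t * 3, fun _ => rfl, by simp, by fun_prop⟩
  obtain ⟨E, hE, hE0, hEc⟩ : ∃ E : ℂ → ℂ, (∀ t, E t = e + t * 9) ∧ e = E 0 ∧ Continuous E :=
    ⟨fun t => e + t * 9, fun _ => rfl, by simp, by fun_prop⟩
  obtain ⟨D, hD, hD0, hDc⟩ : ∃ D : ℂ → ℂ, (∀ t, D t = A t + H t - B t - C t) ∧ d = D 0 ∧
      Continuous D :=
    ⟨fun t => A t + H t - B t - C t, fun _ => rfl, by
      simp only [← hA0, ← hB0, ← hC0, ← hH0]; linear_combination hd, by fun_prop⟩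
  obtain ⟨F, hF, hF0, hFc⟩ : ∃ F : ℂ → ℂ, (∀ t, F t = 2 * A t + (2 * n + 1) * H t - E t) ∧
      f = F 0 ∧ Continuous F :=
    ⟨fun t => 2 * A t + (2 * n + 1) * H t - E t, fun _ => rfl, by
      simp only [← hA0, ← hE0, ← hH0]; linear_combination hf, by fun_prop⟩
  have hdense := dense_cubicGeneric hp a b c e h
  simp only [← hA, ← hB, ← hC, ← hE, ← hH, ← hD] at hdense hG
  clear hA hB hC hE hH hgg hd hf
  subst hH0 hA0 hB0 hC0 hE0 hD0 hF0
  have hs := continuous_oddTheta hp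
  refine eq_of_continuousAt_of_dense
    (F := fun t => ∑ k ∈ Finset.range (n + 1),
        cubicWeight (oddTheta p) (H t) (A t) (B t) (C t) (D t) k *
          cubicFactor (oddTheta p) (H t) n (A t) (E t) (F t) k)
    (G := fun t => cubicPre (oddTheta p) (H t) n (A t) (B t) (C t) (D t) (E t) (G t) *
      ∑ j ∈ Finset.range (n + 1),
        omegaTerm (oddTheta p) (2 * H t) n (A t + G t - C t) (A t - C t) (G t + 2 * H t - C t)
          (B t + E t + G t - A t) (D t) (F t) (G t) j) ?_ ?_ hdense fun t ht =>
    sum_cubic_eq (isOddTheta_oddTheta hp) ht n (by rw [hD]; ring) (by rw [hF]; ring) (hG t)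
  · refine tendsto_finsetSum _ fun k hk => ?_
    have hk : k ≤ n := by simpa [Nat.lt_succ_iff] using hk
    exact (continuousAt_cubicWeight hs hHc hAc hBc hCc hDc k hL₀ (addFac_ne_zero_of_le hk hL₁)
      (addFac_ne_zero_of_le hk hL₂) (addFac_ne_zero_of_le hk hL₃)).mul
      (continuousAt_cubicFactor hs hHc hAc hEc hFc n k (addFac_ne_zero_of_le hk hL₄)
        (addFac_ne_zero_of_le hk hL₅) (addFac_ne_zero_of_le hk hL₆))
  · refine (continuousAt_cubicPre hs hHc hAc hBc hCc hDc hEc hGc n hR₁ hR₂ hL₃ hR₃).mul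
      (tendsto_finsetSum _ fun k hk => ?_)
    have hk : k ≤ n := by simpa [Nat.lt_succ_iff] using hk
    exact continuousAt_omegaTerm hs (h := fun t => 2 * H t) (a := fun t => A t + G t - C t)
      (b := fun t => A t - C t) (c := fun t => G t + 2 * H t - C t)
      (d := fun t => B t + E t + G t - A t) (by fun_prop) (by fun_prop) (by fun_prop)
      (by fun_prop) (by fun_prop) hDc hFc hGc n k hω₀ (addFac_ne_zero_of_le hk hω₁)
      (addFac_ne_zero_of_le hk hω₂) (addFac_ne_zero_of_le hk hω₃) (addFac_ne_zero_of_le hk hω₄)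
      (addFac_ne_zero_of_le hk hω₅) (addFac_ne_zero_of_le hk hω₆) (addFac_ne_zero_of_le hk hω₇)
      (addFac_ne_zero_of_le hk hω₈)

/-! ### Return to multiplicative notation -/

theorem ellFac_exp (p x h : ℂ) (k : ℕ) :
    ellFac (Complex.exp x) (Complex.exp h) p k =
      Complex.exp (k * x / 2 + h * k * (k - 1) / 4) * addFac (oddTheta p) h x k := by
  induction k with
  | zero => simp [ellFac, addFac]
  | succ k ih =>
    rw [addFac_succ_right (y := x + k * h) (hy := rfl), show ellFac (Complex.exp x) (Complex.exp h) p (k + 1) =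
      ellFac (Complex.exp x) (Complex.exp h) p k * ellE (Complex.exp x * Complex.exp h ^ k) p from
        Finset.prod_range_succ _ _, ih, ← Complex.exp_nat_mul, ← Complex.exp_add, ellE_exp,
      show Complex.exp (((k + 1 : ℕ) : ℂ) * x / 2 + h * (k + 1 : ℕ) * ((k + 1 : ℕ) - 1) / 4) =
        Complex.exp (k * x / 2 + h * k * (k - 1) / 4) * Complex.exp ((x + k * h) / 2) by
          rw [← Complex.exp_add]; congr 1; push_cast; ring]
    ring

/-- The exponential prefactor depends only on the sum and the number of the logarithms, so balancing
can cancel it between numerator and denominator. -/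
theorem ellFacs_exp {p q h : ℂ} (hq : q = Complex.exp h) {xs us : List ℂ}
    (hxs : List.Forall₂ (fun x u => x = Complex.exp u) xs us) (k : ℕ) :
    ellFacs xs q p k = Complex.exp (k * us.sum / 2 + us.length * (h * k * (k - 1) / 4)) *
      (us.map fun u => addFac (oddTheta p) h u k).prod := by
  subst hq
  induction hxs with
  | nil => simp [ellFacs]
  | @cons x u xs us hx _ ih =>
    subst hx
    rw [show ellFacs (Complex.exp u :: xs) (Complex.exp h) p k =
      ellFac (Complex.exp u) (Complex.exp h) p k * ellFacs xs (Complex.exp h) p k by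
        simp [ellFacs], ih, ellFac_exp, List.map_cons, List.prod_cons, List.sum_cons,
      List.length_cons, show Complex.exp (k * (u + us.sum) / 2 +
        ((us.length + 1 : ℕ) : ℂ) * (h * k * (k - 1) / 4)) =
        Complex.exp (k * u / 2 + h * k * (k - 1) / 4) *
          Complex.exp (k * us.sum / 2 + us.length * (h * k * (k - 1) / 4)) by
          rw [← Complex.exp_add]; congr 1; push_cast; ring]
    ring

theorem exp_mul_div_exp_mul (u v x y : ℂ) :
    Complex.exp u * x / (Complex.exp v * y) = Complex.exp (u - v) * (x / y) := by
  rw [mul_div_mul_comm, Complex.exp_sub]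

theorem exp_mul_mul_exp_mul (u v w r x y z : ℂ) :
    Complex.exp u * x * (Complex.exp v * y) * (Complex.exp w * z) * Complex.exp r =
      Complex.exp (u + v + w + r) * (x * y * z) := by
  simp only [Complex.exp_add]
  ring

theorem exp_mul_mul_div_exp_mul (u v w r x y z : ℂ) :
    Complex.exp u * x * (Complex.exp v * y * Complex.exp r / (Complex.exp w * z)) =
      Complex.exp (u + v + r - w) * (x * (y / z)) := by
  simp only [Complex.exp_add, Complex.exp_sub]
  ring

theorem oddTheta_ne_zero_of_ellE {p x u : ℂ} (hx : x = Complex.exp u) (h : ellE x p ≠ 0) :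
    oddTheta p u ≠ 0 := by
  rw [hx, ellE_exp] at h
  exact right_ne_zero_of_mul h

theorem addFac_ne_zero_of_ellFacs {p q h : ℂ} {n : ℕ} (hq : q = Complex.exp h) {xs us : List ℂ}
    (hne : ellFacs xs q p n ≠ 0)
    (hxs : List.Forall₂ (fun x u => x = Complex.exp u) xs us) :
    ∀ u ∈ us, addFac (oddTheta p) h u n ≠ 0 := by
  rw [ellFacs_exp hq hxs] at hne
  intro u hu h0
  exact right_ne_zero_of_mul hne
    (List.prod_eq_zero (List.mem_map.2 ⟨u, hu, h0⟩))

theorem ellE_div_ellE_exp {p x y u v : ℂ} (hx : x = Complex.exp u) (hy : y = Complex.exp v) :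
    ellE x p / ellE y p = Complex.exp ((u - v) / 2) * (oddTheta p u / oddTheta p v) := by
  rw [hx, hy, ellE_exp, ellE_exp, exp_mul_div_exp_mul]
  congr 2
  ring

theorem addFac_neg_mul_eq_zero {s : ℂ → ℂ} (hs : s 0 = 0) (h : ℂ) {n k : ℕ} (hk : n < k) :
    addFac s h (-n * h) k = 0 :=
  Finset.prod_eq_zero (Finset.mem_range.2 hk) (by rw [← hs]; congr 1; ring)

theorem cubic_term_exp (p : ℂ) (n : ℕ) (h a b c d e f : ℂ) (hd : b + c + d = a + h)
    (hf : e + f = 2 * a + (2 * n + 1) * h) (k : ℕ) :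
    ellE (.exp a * .exp h ^ (3 * k)) p / ellE (.exp a) p *
      (ellFacs [.exp b, .exp c, .exp d] (.exp h) p k /
        ellFacs [.exp a * .exp h ^ 2 / .exp b, .exp a * .exp h ^ 2 / .exp c,
          .exp a * .exp h ^ 2 / .exp d] (.exp h ^ 2) p k) *
      (ellFacs [.exp e, .exp f, .exp h ^ (-2 * (n : ℤ))] (.exp h ^ 2) p k /
        ellFacs [.exp a * .exp h / .exp e, .exp a * .exp h / .exp f,
          .exp a * .exp h ^ (2 * n + 1)] (.exp h) p k) * .exp h ^ k =
    cubicWeight (oddTheta p) h a b c d k * cubicFactor (oddTheta p) h n a e f k := by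
  have hq : Complex.exp h ^ 2 = Complex.exp (2 * h) := by
    rw [← Complex.exp_nat_mul]; norm_num
  rw [ellE_div_ellE_exp (u := a + 3 * k * h) (v := a)
      (by rw [← Complex.exp_nat_mul, ← Complex.exp_add]; congr 1; push_cast; ring) rfl,
    ellFacs_exp rfl (us := [b, c, d]) (by simp),
    ellFacs_exp hq (us := [a + 2 * h - b, a + 2 * h - c, a + 2 * h - d])
      (by simp [Complex.exp_add, Complex.exp_sub, hq]),
    ellFacs_exp hq (us := [e, f, -n * (2 * h)])
      (by
        simp only [List.forall₂_cons, List.forall₂_nil_left_iff, and_true, true_and,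
          ← Complex.exp_int_mul]
        congr 1; push_cast; ring),
    ellFacs_exp rfl (us := [a + h - e, a + h - f, a + (2 * n + 1) * h])
      (by
        simp only [List.forall₂_cons, List.forall₂_nil_left_iff, and_true, ← Complex.exp_add,
          ← Complex.exp_sub, ← Complex.exp_nat_mul, true_and]
        congr 1; push_cast; ring),
    exp_mul_div_exp_mul, exp_mul_div_exp_mul, ← Complex.exp_nat_mul]
  obtain rfl : d = a + h - b - c := by linear_combination hd
  obtain rfl : f = 2 * a + (2 * n + 1) * h - e := by linear_combination hf
  simp only [List.map_cons, List.map_nil, List.prod_cons, List.prod_nil, mul_one, List.sum_cons,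
    List.sum_nil, add_zero, List.length_cons, List.length_nil]
  -- With d and f eliminated by balancing, the total exponent, including that of q^k, is identically
  -- zero.
  rw [exp_mul_mul_exp_mul, Complex.exp_eq_one_iff.2 ⟨0, by push_cast; ring⟩, one_mul]
  unfold cubicWeight cubicFactor
  simp only [mul_assoc]

theorem cubicPre_exp (p : ℂ) (n : ℕ) (h a b c d e g : ℂ) :
    ellFacs [.exp a * .exp h ^ 2, .exp a ^ 2 * .exp h ^ 2 / (.exp b * .exp c * .exp e),
        .exp a ^ 2 * .exp h ^ 2 / (.exp b * .exp d * .exp e * .exp g),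
        .exp a * .exp g * .exp h ^ 2 / (.exp c * .exp d)] (.exp h ^ 2) p n /
      ellFacs [.exp a ^ 2 * .exp h ^ 2 / (.exp b * .exp e * .exp g),
        .exp a * .exp g * .exp h ^ 2 / .exp c, .exp a * .exp h ^ 2 / .exp d,
        .exp a ^ 2 * .exp h ^ 2 / (.exp b * .exp c * .exp d * .exp e)] (.exp h ^ 2) p n =
    cubicPre (oddTheta p) h n a b c d e g := by
  have hq : Complex.exp h ^ 2 = Complex.exp (2 * h) := by
    rw [← Complex.exp_nat_mul]; norm_num
  have ha : Complex.exp a ^ 2 = Complex.exp (2 * a) := by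
    rw [← Complex.exp_nat_mul]; norm_num
  rw [ellFacs_exp hq (us := [a + 2 * h, 2 * a + 2 * h - b - c - e,
        2 * a + 2 * h - b - d - e - g, a + g + 2 * h - c - d])
      (by simp [Complex.exp_add, Complex.exp_sub, hq, ha, div_div]),
    ellFacs_exp hq (us := [2 * a + 2 * h - b - e - g, a + g + 2 * h - c, a + 2 * h - d,
        2 * a + 2 * h - b - c - d - e])
      (by simp [Complex.exp_add, Complex.exp_sub, hq, ha, div_div]),
    exp_mul_div_exp_mul]
  simp only [List.map_cons, List.map_nil, List.prod_cons, List.prod_nil, mul_one, List.sum_cons,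
    List.sum_nil, add_zero, List.length_cons, List.length_nil]
  rw [Complex.exp_eq_one_iff.2 ⟨0, by push_cast; ring⟩, one_mul]
  unfold cubicPre
  simp only [mul_assoc]

theorem omega_term_exp (p : ℂ) (n : ℕ) (h a b c d e f g : ℂ)
    (hbal : b + c + d + e + f + g = 3 * a + (n + 2) * h) (k : ℕ) {q : ℂ}
    (hq : q = Complex.exp h) {a' : ℂ} (ha : a' = Complex.exp a) {xs : List ℂ}
    (hxs : List.Forall₂ (fun x u => x = Complex.exp u) xs [b, c, d, e, f, g, -n * h]) :
    ellE (a' * q ^ (2 * k)) p / ellE a' p * (ellFacs (a' :: xs) q p k * q ^ k /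
      ellFacs (q :: xs.map fun x => a' * q / x) q p k) =
    omegaTerm (oddTheta p) h n a b c d e f g k := by
  have hys : List.Forall₂ (fun x u => x = Complex.exp u) (q :: xs.map fun x => a' * q / x)
      [h, a + h - b, a + h - c, a + h - d, a + h - e, a + h - f, a + h - g,
        a + (n + 1) * h] := by
    refine .cons hq ?_
    rw [show [a + h - b, a + h - c, a + h - d, a + h - e, a + h - f, a + h - g,
        a + (n + 1) * h] = [b, c, d, e, f, g, -n * h].map fun u => a + h - u by
      simp only [List.map_cons, List.map_nil, List.cons.injEq, and_true, true_and]; ring]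
    rw [List.forall₂_map_left_iff, List.forall₂_map_right_iff]
    refine hxs.imp fun x u hx => ?_
    rw [hx, hq, ha, Complex.exp_sub, Complex.exp_add]
  rw [ellFacs_exp hq hys, ellFacs_exp hq (hxs.cons ha),
    ellE_div_ellE_exp (u := a + 2 * k * h) (v := a)
      (by rw [ha, hq, ← Complex.exp_nat_mul, ← Complex.exp_add]; congr 1; push_cast; ring) ha,
    hq, ← Complex.exp_nat_mul, exp_mul_mul_div_exp_mul]
  obtain rfl : g = 3 * a + (n + 2) * h - b - c - d - e - f := by linear_combination hbal
  simp only [List.map_cons, List.map_nil, List.prod_cons, List.prod_nil, mul_one, List.sum_cons,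
    List.sum_nil, add_zero, List.length_cons, List.length_nil]
  rw [Complex.exp_eq_one_iff.2 ⟨0, by push_cast; ring⟩, one_mul]
  unfold omegaTerm
  simp only [mul_assoc]

theorem ellOmega_exp {p : ℂ} (hp : ‖p‖ < 1) (n : ℕ) (h a b c d e f g : ℂ)
    (hbal : b + c + d + e + f + g = 3 * a + (n + 2) * h) {q : ℂ}
    (hq : q = Complex.exp h) {a' : ℂ} (ha : a' = Complex.exp a) {xs : List ℂ}
    (hxs : List.Forall₂ (fun x u => x = Complex.exp u) xs [b, c, d, e, f, g, -n * h]) :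
    ellOmega a' xs q p =
      ∑ k ∈ Finset.range (n + 1), omegaTerm (oddTheta p) h n a b c d e f g k := by
  unfold ellOmega
  simp only [omega_term_exp p n h a b c d e f g hbal _ hq ha hxs]
  -- Beyond k = n the numerator factorial of -nh contains s(0) = 0, so the infinite series is a
  -- finite sum even where later denominators vanish.
  refine tsum_eq_sum fun k hk => ?_
  rw [Finset.mem_range, not_lt] at hk
  unfold omegaTerm
  rw [addFac_neg_mul_eq_zero (isOddTheta_oddTheta hp).zero h hk]
  simp

theorem exists_exp_eq {x : ℂ} (hx : x ≠ 0) : ∃ u, x = Complex.exp u :=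
  ⟨Complex.log x, (Complex.exp_log hx).symm⟩

/-! ### The theorem in its original form -/

theorem mainTheorem2 (n : ℕ) (p q a b c d e f g : ℂ)
    (hp : ‖p‖ < 1) (hq : q ≠ 0) (ha : a ≠ 0)
    (hbcd : b * c * d = a * q)
    (hef : e * f = a ^ 2 * q ^ (2 * n + 1))
    (hg : g = a / b ∨ g = a / e)
    -- none of the denominators on the left-hand side vanishes
    (hL₀ : ellE a p ≠ 0)
    (hL₁ : ellFacs [a * q ^ 2 / b, a * q ^ 2 / c, a * q ^ 2 / d] (q ^ 2) p n ≠ 0)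
    (hL₂ : ellFacs [a * q / e, a * q / f, a * q ^ (2 * n + 1)] q p n ≠ 0)
    -- the denominator of the prefactor on the right-hand side does not vanish
    (hR : ellFacs [a ^ 2 * q ^ 2 / (b * e * g), a * g * q ^ 2 / c, a * q ^ 2 / d,
        a ^ 2 * q ^ 2 / (b * c * d * e)] (q ^ 2) p n ≠ 0)
    -- none of the denominators of the terms `k = 0, …, n` of the terminating series vanishes
    (hω₀ : ellE (a * g / c) p ≠ 0)
    (hω : ellFacs [q ^ 2, g * q ^ 2, a, a ^ 2 * q ^ 2 / (b * c * e), a * g * q ^ 2 / (c * d),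
        a * g * q ^ 2 / (c * f), a * q ^ 2 / c, a * g * q ^ (2 * n + 2) / c] (q ^ 2) p n ≠ 0) :
    ∑ k ∈ Finset.range (n + 1),
        ellE (a * q ^ (3 * k)) p / ellE a p *
          (ellFacs [b, c, d] q p k /
            ellFacs [a * q ^ 2 / b, a * q ^ 2 / c, a * q ^ 2 / d] (q ^ 2) p k) *
          (ellFacs [e, f, q ^ (-2 * (n : ℤ))] (q ^ 2) p k /
            ellFacs [a * q / e, a * q / f, a * q ^ (2 * n + 1)] q p k) * q ^ k
      = ellFacs [a * q ^ 2, a ^ 2 * q ^ 2 / (b * c * e), a ^ 2 * q ^ 2 / (b * d * e * g),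
            a * g * q ^ 2 / (c * d)] (q ^ 2) p n /
          ellFacs [a ^ 2 * q ^ 2 / (b * e * g), a * g * q ^ 2 / c, a * q ^ 2 / d,
            a ^ 2 * q ^ 2 / (b * c * d * e)] (q ^ 2) p n *
        ellOmega (a * g / c)
          [a / c, g * q ^ 2 / c, b * e * g / a, d, f, g, q ^ (-2 * (n : ℤ))] (q ^ 2) p := by
  -- The constraints force b, c, d, e, f to be nonzero, so logarithms exist.
  have hbcd0 : b * c * d ≠ 0 := hbcd ▸ mul_ne_zero ha hq
  have hef0 : e * f ≠ 0 := hef ▸ mul_ne_zero (pow_ne_zero _ ha) (pow_ne_zero _ hq)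
  obtain ⟨a, rfl⟩ := exists_exp_eq ha
  obtain ⟨h, rfl⟩ := exists_exp_eq hq
  obtain ⟨b, rfl⟩ := exists_exp_eq (left_ne_zero_of_mul (left_ne_zero_of_mul hbcd0))
  obtain ⟨c, rfl⟩ := exists_exp_eq (right_ne_zero_of_mul (left_ne_zero_of_mul hbcd0))
  obtain ⟨e, rfl⟩ := exists_exp_eq (left_ne_zero_of_mul hef0)
  -- The logarithms of d, f and g are defined by the constraints, so that the additive relations
  -- hold exactly and not only modulo 2πi.
  obtain ⟨d, rfl, hd⟩ : ∃ u, d = Complex.exp u ∧ b + c + u = a + h := by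
    refine ⟨a + h - (b + c), ?_, by ring⟩
    rw [Complex.exp_sub, Complex.exp_add, Complex.exp_add, ← hbcd, mul_div_cancel_left₀]
    exact left_ne_zero_of_mul hbcd0
  obtain ⟨f, rfl, hf⟩ : ∃ u, f = Complex.exp u ∧ e + u = 2 * a + (2 * n + 1) * h := by
    refine ⟨(2 : ℕ) * a + (2 * n + 1 : ℕ) * h - e, ?_, by push_cast; ring⟩
    rw [Complex.exp_sub, Complex.exp_add, Complex.exp_nat_mul, Complex.exp_nat_mul, ← hef,
      mul_div_cancel_left₀ _ (Complex.exp_ne_zero e)]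
  obtain ⟨g, rfl, hgg⟩ : ∃ u, g = Complex.exp u ∧ (u = a - b ∨ u = a - e) := by
    rcases hg with rfl | rfl
    · exact ⟨a - b, (Complex.exp_sub _ _).symm, .inl rfl⟩
    · exact ⟨a - e, (Complex.exp_sub _ _).symm, .inr rfl⟩
  clear hbcd hef hg hbcd0 hef0 ha hq
  have hq : Complex.exp h ^ 2 = Complex.exp (2 * h) := by
    rw [← Complex.exp_nat_mul]; norm_num
  have ha : Complex.exp a ^ 2 = Complex.exp (2 * a) := by
    rw [← Complex.exp_nat_mul]; norm_num
  simp only [cubic_term_exp p n h a b c d e f hd hf, cubicPre_exp p n h a b c d e g]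
  rw [ellOmega_exp hp n (2 * h) (a + g - c) (a - c) (g + 2 * h - c) (b + e + g - a) d f g
    (by linear_combination hd + hf) hq (by rw [Complex.exp_sub, Complex.exp_add])
    (by
      simp only [List.forall₂_cons, List.forall₂_nil_left_iff, and_true, true_and,
        ← Complex.exp_int_mul, hq, ← Complex.exp_add, ← Complex.exp_sub]
      congr 1; push_cast; ring)]
  have hL₁ := addFac_ne_zero_of_ellFacs hq hL₁
    (us := [a + 2 * h - b, a + 2 * h - c, a + 2 * h - d])
    (by simp [Complex.exp_add, Complex.exp_sub, hq])
  have hL₂ := addFac_ne_zero_of_ellFacs rfl hL₂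
    (us := [a + h - e, a + h - f, a + (2 * n + 1) * h])
    (by
      simp only [List.forall₂_cons, List.forall₂_nil_left_iff, and_true, ← Complex.exp_add,
        ← Complex.exp_sub, ← Complex.exp_nat_mul, true_and]
      congr 1; push_cast; ring)
  have hR := addFac_ne_zero_of_ellFacs hq hR
    (us := [2 * a + 2 * h - b - e - g, a + g + 2 * h - c, a + 2 * h - d,
      2 * a + 2 * h - b - c - d - e])
    (by simp [Complex.exp_add, Complex.exp_sub, hq, ha, div_div])
  have hω := addFac_ne_zero_of_ellFacs hq hω
    (us := [2 * h, a + g - c + 2 * h - (a - c), a + g - c + 2 * h - (g + 2 * h - c),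
      a + g - c + 2 * h - (b + e + g - a), a + g - c + 2 * h - d, a + g - c + 2 * h - f,
      a + g - c + 2 * h - g, a + g - c + (n + 1) * (2 * h)])
    (by
      simp only [List.forall₂_cons, List.forall₂_nil_left_iff, and_true, ← Complex.exp_add,
        ← Complex.exp_sub, ← Complex.exp_nat_mul]
      refine ⟨?_, ?_, ?_, ?_, ?_, ?_, ?_, ?_⟩ <;> congr 1 <;> push_cast <;> ring)
  simp only [List.forall_mem_cons, List.not_mem_nil, false_imp_iff, implies_true, and_true]
    at hL₁ hL₂ hR hω
  obtain ⟨l1, l2, l3⟩ := hL₁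
  obtain ⟨l4, l5, l6⟩ := hL₂
  obtain ⟨r1, r2, -, r3⟩ := hR
  obtain ⟨w1, w2, w3, w4, w5, w6, w7, w8⟩ := hω
  exact sum_cubic_eq_of_ne_zero hp n hd hf hgg (oddTheta_ne_zero_of_ellE rfl hL₀) l1 l2 l3 l4 l5 l6
    r1 r2 r3 (oddTheta_ne_zero_of_ellE (by rw [Complex.exp_sub, Complex.exp_add]) hω₀)
    w1 w2 w3 w4 w5 w6 w7 w8
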